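/- Let $M$ be a Hausdorff $C^\infty$ manifold of dimension $n$ and let $F:TM\to\mathbb R$ be a Finsler metric: $F$ is continuous on $TM$, of class $C^\infty$ and positive off the zero section, positively homogeneous of degree $1$ on each tangent space (that is, $F(x,aX)=aF(x,X)$ for $a>0$), and the matrix $g_{ij}=\tfrac12\,\partial^2F^2/\partial X^i\partial X^j$ is positive definite at every nonzero tangent vector. A geodesic $c:[0,1]\to M$ of $F$ is a $C^2$ curve (possibly constant) that satisfies the Euler–Lagrange equations of $\tfrac12F^2$; its length is $\int_0^1F(c(t),\dot c(t))\,dt$. For $X\in T_xM$ put $Exp_x(X)=c_X(1)$ whenever there is a geodesic $c_X:[0,1]\to M$ with $c_X(0)=x$ and $\dot c_X(0)=X$. For $x\in M$ and $\rho>0$ let $B_\rho(0_x)=\{X\in T_xM : F(x,X)<\rho\}$ and $B_\rho(x)=Exp_x(B_\rho(0_x))$. **Proposition (existence of convex neighbourhoods).** For each $x\in M$ there exist real numbers $\varepsilon=\varepsilon(x)$ and $\eta=\eta(x)$ with $0<\varepsilon<\eta$ such that: i) $Exp_x$ is defined on $B_\varepsilon(0_x)$ and $Exp_x:B_\varepsilon(0_x)\to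 B_\varepsilon(x)$ is a diffeomorphism, of class $C^1$ on $B_\varepsilon(0_x)$ and of class $C^\infty$ on $B_\varepsilon(0_x)\setminus\{0_x\}$; moreover $B_\varepsilon(x)$ is an open neighbourhood of $x$. ii) For all $y,z\in B_\varepsilon(x)$ there exists a unique geodesic $c:[0,1]\to M$ with $c(0)=y$ and $c(1)=z$ that lies entirely in $B_\eta(y)$ and has length less than $\eta$. iii) For every $y\in B_\varepsilon(x)$, $Exp_y$ is defined on $B_\eta(0_y)$ and $Exp_y:B_\eta(0_y)\to B_\eta(y)$ is a diffeomorphism, of class $C^1$ on $B_\eta(0_y)$ and of class $C^\infty$ on $B_\eta(0_y)\setminus\{0_y\}$; moreover $B_\eta(y)$ is an open neighbourhood of $y$ containing $B_\varepsilon(x)$. -/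

import Mathlib

open Set
open scoped Manifold ContDiff

noncomputable section

namespace Finsler

variable {n : ℕ} {M : Type*} [TopologicalSpace M] [ChartedSpace (EuclideanSpace ℝ (Fin n)) M]

/-- The fundamental tensor
`g_{(x,v)}(w, u) = (1/2) ∂²/∂s∂t F²(x, v + s w + t u)` at `s = t = 0`. -/
def fundamentalTensor (F : TangentBundle (𝓡 n) M → ℝ) (x : M)
    (v w u : TangentSpace (𝓡 n) x) : ℝ :=
  (1 / 2) * deriv (fun s : ℝ => deriv (fun t : ℝ =>
    F (⟨x, v + s • w + t • u⟩ : TangentBundle (𝓡 n) M) ^ 2) 0) 0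

/-- `F : TM → ℝ` is a Finsler metric: continuous on `TM`, smooth off the zero section, positive
off the zero section, positively homogeneous of degree one on the fibres (no reversibility is
required), with positive definite fundamental tensor. -/
structure IsFinslerMetric [IsManifold (𝓡 n) ∞ M] (F : TangentBundle (𝓡 n) M → ℝ) : Prop where
  continuous : Continuous F
  smooth : ContMDiffOn (𝓡 n).tangent 𝓘(ℝ, ℝ) ∞ F {X | X.2 ≠ 0}
  pos : ∀ (x : M) (v : TangentSpace (𝓡 n) x), v ≠ 0 → 0 < F ⟨x, v⟩
  homogeneous : ∀ (x : M) (v : TangentSpace (𝓡 n) x) (a : ℝ), 0 < a →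
    F ⟨x, a • v⟩ = a * F ⟨x, v⟩
  posDef : ∀ (x : M) (v w : TangentSpace (𝓡 n) x), v ≠ 0 → w ≠ 0 →
    0 < fundamentalTensor F x v w w

/-- The energy Lagrangian `F² / 2` in the coordinates `(u, w)` that a chart `e` of `M`
induces on `TM`. -/
def localEnergy (F : TangentBundle (𝓡 n) M → ℝ)
    (e : OpenPartialHomeomorph M (EuclideanSpace ℝ (Fin n)))
    (u w : EuclideanSpace ℝ (Fin n)) : ℝ :=
  (1 / 2) * F ⟨e.symm u, mfderiv (𝓡 n) (𝓡 n) e.symm u w⟩ ^ 2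

/-- The velocity `(c(t), ċ(t)) ∈ TM` of a curve `c : [0,1] → M` (one-sided at the end points). -/
def velocity (c : ℝ → M) (t : ℝ) : TangentBundle (𝓡 n) M :=
  ⟨c t, mfderivWithin 𝓘(ℝ, ℝ) (𝓡 n) c (Icc 0 1) t (1 : ℝ)⟩

/-- `c : [0,1] → M` is an (affinely parametrised, possibly constant) geodesic of `F`: it is `C²`
and in every chart it solves the Euler-Lagrange equation `d/dt (∂L/∂w)(c, ċ) = (∂L/∂u)(c, ċ)` of
the energy `L(u, w) = F²/2`. Only the values of `c` on `[0,1]` matter. -/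
structure IsGeodesic (F : TangentBundle (𝓡 n) M → ℝ) (c : ℝ → M) : Prop where
  contMDiffOn : ContMDiffOn 𝓘(ℝ, ℝ) (𝓡 n) 2 c (Icc 0 1)
  eulerLagrange : ∀ e ∈ atlas (EuclideanSpace ℝ (Fin n)) M, ∀ t ∈ Icc (0 : ℝ) 1,
    c t ∈ e.source →
      HasDerivWithinAt
        (fun τ : ℝ => fderiv ℝ (fun w => localEnergy F e (e (c τ)) w)
          (derivWithin (fun r => e (c r)) (Icc 0 1) τ))
        (fderiv ℝ (fun u => localEnergy F e u (derivWithin (fun r => e (c r)) (Icc 0 1) t))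
          (e (c t)))
        (Icc 0 1) t

/-- The Finslerian length of a curve `c : [0,1] → M`. -/
def length (F : TangentBundle (𝓡 n) M → ℝ) (c : ℝ → M) : ℝ :=
  ∫ t in (0 : ℝ)..1, F (velocity c t)

/-- The set of all `X ∈ TM` for which the geodesic with initial velocity `X` exists on `[0,1]`. -/
def expDomain (F : TangentBundle (𝓡 n) M → ℝ) : Set (TangentBundle (𝓡 n) M) :=
  {X | ∃ c : ℝ → M, IsGeodesic F c ∧ velocity c 0 = X}

open Classical in
/-- The exponential map: `Exp(X) = c_X(1)`, where `c_X` is the geodesic with initial velocity `X`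
(the foot point of `X`, as a dummy value, off the domain). -/
def Exp (F : TangentBundle (𝓡 n) M → ℝ) (X : TangentBundle (𝓡 n) M) : M :=
  if h : ∃ c : ℝ → M, IsGeodesic F c ∧ velocity c 0 = X then h.choose 1 else X.1

/-- The exponential map `Exp_x` at the point `x`, on `T_x M = ℝⁿ`. -/
def expAt (F : TangentBundle (𝓡 n) M → ℝ) (x : M) (v : EuclideanSpace ℝ (Fin n)) : M :=
  Exp F ⟨x, v⟩

/-- The open indicatrix `B_ρ(0_x) ⊆ T_x M = ℝⁿ`. -/
def indicatrix (F : TangentBundle (𝓡 n) M → ℝ) (x : M) (ρ : ℝ) :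
    Set (EuclideanSpace ℝ (Fin n)) :=
  {v | F ⟨x, v⟩ < ρ}

/-- The set `B_ρ(x) = Exp_x(B_ρ(0_x))`. -/
def expBall (F : TangentBundle (𝓡 n) M → ℝ) (x : M) (ρ : ℝ) : Set M :=
  expAt F x '' indicatrix F x ρ

/-- `f`, restricted to `s`, is a diffeomorphism of class `C^k` of the open set `s` onto the open
set `f '' s`. -/
def IsDiffeoOn (k : ℕ∞ω) (f : EuclideanSpace ℝ (Fin n) → M)
    (s : Set (EuclideanSpace ℝ (Fin n))) : Prop :=
  IsOpen s ∧ IsOpen (f '' s) ∧ ContMDiffOn (𝓡 n) (𝓡 n) k f s ∧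
    ∃ g : M → EuclideanSpace ℝ (Fin n), LeftInvOn g f s ∧ ContMDiffOn (𝓡 n) (𝓡 n) k g (f '' s)

/-- `Exp_x` is defined on `B_ρ(0_x)` and is a diffeomorphism of it onto `B_ρ(x)`, of class `C^1`
on `B_ρ(0_x)` and of class `C^∞` on `B_ρ(0_x) - {0_x}`. -/
structure IsExpDiffeo (F : TangentBundle (𝓡 n) M → ℝ) (x : M) (ρ : ℝ) : Prop where
  subset_domain : ∀ v ∈ indicatrix F x ρ, (⟨x, v⟩ : TangentBundle (𝓡 n) M) ∈ expDomain F
  diffeo_one : IsDiffeoOn 1 (expAt F x) (indicatrix F x ρ)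
  diffeo_infty : IsDiffeoOn ∞ (expAt F x) (indicatrix F x ρ \ {0})

/-- `c : [0,1] → M` is a geodesic from `y` to `z` lying in `B_η(y)`, of length less than `η`. -/
structure IsShortGeodesic (F : TangentBundle (𝓡 n) M → ℝ) (η : ℝ) (y z : M) (c : ℝ → M) :
    Prop where
  isGeodesic : IsGeodesic F c
  source : c 0 = y
  target : c 1 = z
  mapsTo : MapsTo c (Icc 0 1) (expBall F y η)
  length_lt : length F c < η

end Finsler

end

/-! In a chart the Euler–Lagrange equation becomes γ'' = G(γ, γ'), where the spray G is smooth off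
zero velocity and positively homogeneous of degree two in the velocity. Positive definiteness of the
fundamental tensor is what allows solving for γ''. Multiplying G by a bump function in the position
gives a global field f, and homogeneity with compactness gives ‖f(u, w)‖ ≤ C‖w‖² and Lipschitz
constant Cρ on {‖w‖ ≤ ρ}, ρ ≤ 1 (`IsQuadraticField`).

For such f the velocity v of the solution is a fixed point in C([0,1], V) of v ↦ w + ∫ f(u + ∫v, v),
a contraction as soon as Cρ ≤ 1/4. The time one map E_u, which is Exp in coordinates, satisfies
‖E_u(w) - E_u(w') - (w - w')‖ ≤ 2Cs‖w - w'‖ for ‖w‖, ‖w'‖ ≤ s ≤ ρ/2 (`norm_timeOneMap_sub_sub_le`).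
Everything about Exp near the zero section follows from this estimate, with constants independent of
u: derivative the identity at 0, class C¹ there, injectivity, and images of balls containing balls
of comparable radius. Away from w = 0 the velocity stays at least ‖w‖/2, so the solution never meets
the singular locus of f, and smoothness in w is the implicit function theorem in C([0,1], V)
(`contDiffAt_velocityPath`).

Back on M, ODE uniqueness in the chart (`eqOn_of_velocity_eq`) identifies Exp with E_u. Comparing F
with the Euclidean norm on a compact piece of the chart gives η such that Exp_y is a diffeomorphism
on B_η(0_y) for all y near x, and a smaller ε such that B_ε(x) ⊆ B_η(y). For y, z in B_ε(x), writing
z = Exp_y(v) gives the geodesic t ↦ Exp_y(tv). A competitor inside B_η(y) has constant speed, so its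
length bounds its initial vector below η, and injectivity of Exp_y forces that vector to be v. -/

namespace Finsler

open scoped Topology

/-! ### Smoothness of superposition operators on spaces of continuous maps -/

section Nemytskii

open scoped unitInterval

/-- The superposition operator `g ↦ f ∘ g` on continuous functions. -/
def superposition (K : Type*) {V W : Type*} [TopologicalSpace K] [TopologicalSpace V]
    [TopologicalSpace W] (f : C(V, W)) (g : C(K, V)) : C(K, W) :=
  f.comp g

@[simp] theorem superposition_apply {K V W : Type*} [TopologicalSpace K] [TopologicalSpace V]
    [TopologicalSpace W] (f : C(V, W)) (g : C(K, V)) (t : K) :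
    superposition K f g t = f (g t) := rfl

universe u

variable {K : Type*} {V W : Type u} [TopologicalSpace K] [CompactSpace K]
  [NormedAddCommGroup V] [NormedSpace ℝ V] [NormedAddCommGroup W] [NormedSpace ℝ W]

/-- Pointwise evaluation of a family of continuous linear maps on a family of vectors. -/
noncomputable def pointwiseApply (K V W : Type*) [TopologicalSpace K] [CompactSpace K]
    [NormedAddCommGroup V] [NormedSpace ℝ V] [NormedAddCommGroup W] [NormedSpace ℝ W] :
    C(K, V →L[ℝ] W) →L[ℝ] C(K, V) →L[ℝ] C(K, W) :=
  LinearMap.mkContinuous₂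
    (LinearMap.mk₂ ℝ (fun (A : C(K, V →L[ℝ] W)) (h : C(K, V)) =>
        (⟨fun t => A t (h t), by fun_prop⟩ : C(K, W)))
      (fun _ _ _ => by ext; simp) (fun _ _ _ => by ext; simp)
      (fun _ _ _ => by ext; simp) (fun _ _ _ => by ext; simp))
    1 (fun A h => by
      rw [one_mul]
      refine (ContinuousMap.norm_le _ (by positivity)).2 fun t => ?_
      exact ((A t).le_opNorm (h t)).trans
        (mul_le_mul (A.norm_coe_le_norm t) (h.norm_coe_le_norm t) (by positivity) (by positivity)))

@[simp] theorem pointwiseApply_apply (A : C(K, V →L[ℝ] W)) (h : C(K, V)) (t : K) :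
    pointwiseApply K V W A h t = A t (h t) := rfl

/-- Postcomposition with f' is continuous for the sup norm, so f' varies by at most c along the
segments from g t to g' t, uniformly in t. The mean value inequality at each t does the rest. -/
theorem hasFDerivAt_superposition (f : C(V, W)) (f' : C(V, V →L[ℝ] W))
    (hf : ∀ x, HasFDerivAt f (f' x) x) (g : C(K, V)) :
    HasFDerivAt (superposition K f) (pointwiseApply K V W (superposition K f' g)) g := by
  rw [hasFDerivAt_iff_isLittleO, Asymptotics.isLittleO_iff]
  intro c hc
  have hcont : Continuous (superposition K f') := f'.continuous_postcomp
  obtain ⟨δ, hδ, hball⟩ :=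
    (Metric.continuous_iff (f := superposition K f')).1 hcont g c hc
  filter_upwards [Metric.ball_mem_nhds g hδ] with g' hg'
  refine (ContinuousMap.norm_le _ (by positivity)).2 fun t => ?_
  have key := (convex_segment (𝕜 := ℝ) (g t) (g' t)).norm_image_sub_le_of_norm_hasFDerivWithin_le'
    (f := f) (f' := f') (φ := f' (g t)) (C := c)
    (fun x _ => (hf x).hasFDerivWithinAt) ?_ (left_mem_segment ℝ _ _) (right_mem_segment ℝ _ _)
  · refine le_trans (le_of_eq ?_) (key.trans ?_)
    · simp
    · gcongr
      exact (g' - g).norm_coe_le_norm t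
  · intro x hx
    rw [segment_eq_image'] at hx
    obtain ⟨θ, hθ, rfl⟩ := hx
    have hd : dist (g + θ • (g' - g)) g < δ := by
      rw [dist_eq_norm, add_sub_cancel_left, norm_smul, Real.norm_of_nonneg hθ.1]
      have h1 : ‖g' - g‖ < δ := by rwa [← dist_eq_norm]
      nlinarith [norm_nonneg (g' - g), hθ.2]
    have h2 := hball _ hd
    have h3 := (ContinuousMap.dist_apply_le_dist t).trans h2.le
    rwa [dist_eq_norm] at h3

/-- The derivative is again a superposition operator, that of `fderiv ℝ f`, followed by the bounded
map `pointwiseApply`. The induction changes the target to V →L[ℝ] W, so V and W share a universe. -/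
theorem contDiff_superposition (f : C(V, W)) (hf : ContDiff ℝ ∞ f) :
    ContDiff ℝ ∞ (superposition K f) := by
  rw [contDiff_infty]
  intro k
  induction k generalizing W with
  | zero => exact contDiff_zero.2 f.continuous_postcomp
  | succ k ih =>
    have hf1 : ContDiff ℝ ∞ (fderiv ℝ f) := hf.fderiv_right (by simp)
    refine contDiff_succ_iff_hasFDerivAt.2
      ⟨fun g => pointwiseApply K V W (superposition K ⟨fderiv ℝ f, hf1.continuous⟩ g), ?_, ?_⟩
    · exact (pointwiseApply K V W).contDiff.comp (ih ⟨fderiv ℝ f, hf1.continuous⟩ hf1)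
    · exact fun g => hasFDerivAt_superposition f _
        (fun x => (hf.differentiable (by simp) x).hasFDerivAt) g

end Nemytskii

/-! ### The integration operator on paths over the unit interval -/

section Volterra

open scoped unitInterval

variable {V : Type*} [NormedAddCommGroup V]

/-- The constant extension of a path to the real line. -/
noncomputable def extendPath (a : C(I, V)) : ℝ → V := IccExtend (zero_le_one' ℝ) a

theorem continuous_extendPath (a : C(I, V)) : Continuous (extendPath a) :=
  a.continuous.Icc_extend'

theorem extendPath_of_mem (a : C(I, V)) {t : ℝ} (ht : t ∈ Icc (0 : ℝ) 1) :
    extendPath a t = a ⟨t, ht⟩ :=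
  IccExtend_of_mem _ _ ht

theorem norm_extendPath_le (a : C(I, V)) (t : ℝ) : ‖extendPath a t‖ ≤ ‖a‖ :=
  a.norm_coe_le_norm _

variable [NormedSpace ℝ V]

/-- The primitive of a path that vanishes at `0`. -/
noncomputable def volterra (V : Type*) [NormedAddCommGroup V] [NormedSpace ℝ V] :
    C(I, V) →L[ℝ] C(I, V) :=
  LinearMap.mkContinuous
    { toFun := fun a => ⟨fun t : I => ∫ s in (0 : ℝ)..t, extendPath a s,
        (intervalIntegral.continuous_primitive
          (fun _ _ => (continuous_extendPath a).intervalIntegrable _ _) 0).comp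
          continuous_subtype_val⟩
      map_add' := fun a b => by
        ext t
        exact intervalIntegral.integral_add ((continuous_extendPath a).intervalIntegrable _ _)
          ((continuous_extendPath b).intervalIntegrable _ _)
      map_smul' := fun r a => by
        ext t
        exact intervalIntegral.integral_smul r _ }
    1 (fun a => by
      rw [one_mul]
      refine (ContinuousMap.norm_le _ (norm_nonneg _)).2 fun t => ?_
      refine (intervalIntegral.norm_integral_le_of_norm_le_const (C := ‖a‖)
        fun s _ => norm_extendPath_le a s).trans ?_
      rw [sub_zero, abs_of_nonneg t.2.1]
      exact mul_le_of_le_one_right (norm_nonneg _) t.2.2)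

theorem volterra_apply (a : C(I, V)) (t : I) :
    volterra V a t = ∫ s in (0 : ℝ)..t, extendPath a s := rfl

theorem norm_volterra_le (a : C(I, V)) : ‖volterra V a‖ ≤ ‖a‖ := by
  have := (volterra V).le_of_opNorm_le (LinearMap.mkContinuous_norm_le _ zero_le_one _) a
  rwa [one_mul] at this

theorem volterra_zero (a : C(I, V)) : volterra V a 0 = 0 := by
  rw [volterra_apply]; simp

theorem hasDerivWithinAt_extendPath_volterra [CompleteSpace V] (a : C(I, V)) {t : ℝ}
    (ht : t ∈ Icc (0 : ℝ) 1) :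
    HasDerivWithinAt (extendPath (volterra V a)) (a ⟨t, ht⟩) (Icc 0 1) t := by
  have h := ((continuous_extendPath a).integral_hasStrictDerivAt 0 t).hasDerivAt.hasDerivWithinAt
    (s := Icc (0 : ℝ) 1)
  rw [extendPath_of_mem a ht] at h
  refine h.congr (fun s hs => ?_) ?_
  · rw [extendPath_of_mem _ hs, volterra_apply]
  · rw [extendPath_of_mem _ ht, volterra_apply]

end Volterra

/-! ### Solving γ'' = f(γ, γ') for small velocities by a contraction -/

section QuadraticField

open scoped unitInterval

variable {V : Type*} [NormedAddCommGroup V] [NormedSpace ℝ V]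

/-- The right hand side `f` of a second order equation `γ'' = f (γ, γ')` which is positively
homogeneous of degree two in the velocity, smooth away from zero velocity, and satisfies the
estimates that this entails, uniformly in the position. The normalisation `1 ≤ C` makes
`C * ρ ≤ 1 / 4` a smallness condition on `ρ`. -/
structure IsQuadraticField (f : C(V × V, V)) (C : ℝ) : Prop where
  smooth : ContDiffOn ℝ ∞ f {z | z.2 ≠ 0}
  one_le : 1 ≤ C
  bound : ∀ z, ‖f z‖ ≤ C * ‖z.2‖ ^ 2
  lipschitz : ∀ ρ z z', ρ ≤ 1 → ‖z.2‖ ≤ ρ → ‖z'.2‖ ≤ ρ → ‖f z - f z'‖ ≤ C * ρ * ‖z - z'‖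
  homogeneous : ∀ u w (a : ℝ), 0 < a → f (u, a • w) = a ^ 2 • f (u, w)

theorem IsQuadraticField.nonneg {f : C(V × V, V)} {C : ℝ} (hf : IsQuadraticField f C) : 0 ≤ C :=
  zero_le_one.trans hf.one_le

theorem IsQuadraticField.le_one {f : C(V × V, V)} {C ρ : ℝ} (hf : IsQuadraticField f C)
    (hρ : C * ρ ≤ 1 / 4) : ρ ≤ 1 := by
  have := hf.one_le
  nlinarith

/-- The path `t ↦ (u + ∫₀ᵗ v, v t)` of positions and velocities with velocity `v`. -/
noncomputable def phasePath (u : V) (v : C(I, V)) : C(I, V × V) :=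
  (ContinuousMap.const I u + volterra V v).prodMk v

@[simp] theorem phasePath_apply (u : V) (v : C(I, V)) (t : I) :
    phasePath u v t = (u + volterra V v t, v t) := rfl

/-- The integral operator whose fixed points are the velocities of the solutions of
`γ'' = f (γ, γ')`, `γ 0 = u`, `γ' 0 = w`. -/
noncomputable def picardMap (f : C(V × V, V)) (u w : V) (v : C(I, V)) : C(I, V) :=
  ContinuousMap.const I w + volterra V (superposition I f (phasePath u v))

theorem norm_phasePath_sub_le (u : V) (v v' : C(I, V)) :
    ‖phasePath u v - phasePath u v'‖ ≤ ‖v - v'‖ := by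
  refine (ContinuousMap.norm_le _ (norm_nonneg _)).2 fun t => ?_
  refine (Prod.norm_def _).trans_le (max_le ?_ ((v - v').norm_coe_le_norm t))
  have : (phasePath u v - phasePath u v') t = (volterra V (v - v') t, (v - v') t) := by
    rw [map_sub]; ext <;> simp
  rw [this]
  exact ((volterra V (v - v')).norm_coe_le_norm t).trans (norm_volterra_le _)

theorem IsQuadraticField.norm_superposition_sub_le {f : C(V × V, V)} {C : ℝ}
    (hf : IsQuadraticField f C) {ρ : ℝ} (hρ1 : ρ ≤ 1) (u : V) {v v' : C(I, V)}
    (hv : ‖v‖ ≤ ρ) (hv' : ‖v'‖ ≤ ρ) :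
    ‖superposition I f (phasePath u v) - superposition I f (phasePath u v')‖
      ≤ C * ρ * ‖v - v'‖ := by
  have hρ : 0 ≤ ρ := (norm_nonneg _).trans hv
  have hC := hf.nonneg
  refine (ContinuousMap.norm_le _ (by positivity)).2 fun t => ?_
  refine (hf.lipschitz ρ _ _ hρ1 ((v.norm_coe_le_norm t).trans hv)
    ((v'.norm_coe_le_norm t).trans hv')).trans ?_
  gcongr
  exact ((phasePath u v - phasePath u v').norm_coe_le_norm t).trans (norm_phasePath_sub_le u v v')

theorem IsQuadraticField.norm_superposition_le {f : C(V × V, V)} {C : ℝ}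
    (hf : IsQuadraticField f C) (u : V) (v : C(I, V)) :
    ‖superposition I f (phasePath u v)‖ ≤ C * ‖v‖ ^ 2 := by
  have hC := hf.nonneg
  refine (ContinuousMap.norm_le _ (by positivity)).2 fun t => (hf.bound _).trans ?_
  gcongr
  exact v.norm_coe_le_norm t

/-- Keeping the term w - w' explicit lets one estimate serve both for the contraction (w = w') and
for the dependence on w. -/
theorem IsQuadraticField.norm_picardMap_sub_le {f : C(V × V, V)} {C : ℝ}
    (hf : IsQuadraticField f C) {ρ : ℝ} (hρ1 : ρ ≤ 1) (u w w' : V) {v v' : C(I, V)}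
    (hv : ‖v‖ ≤ ρ) (hv' : ‖v'‖ ≤ ρ) :
    ‖picardMap f u w v - picardMap f u w' v' - ContinuousMap.const I (w - w')‖
      ≤ C * ρ * ‖v - v'‖ := by
  have : picardMap f u w v - picardMap f u w' v' - ContinuousMap.const I (w - w') =
      volterra V (superposition I f (phasePath u v) - superposition I f (phasePath u v')) := by
    rw [map_sub]; ext t; simp [picardMap]; abel
  rw [this]
  exact (norm_volterra_le _).trans (hf.norm_superposition_sub_le hρ1 u hv hv')

theorem norm_const_unitInterval {V : Type*} [NormedAddCommGroup V] (w : V) :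
    ‖ContinuousMap.const I w‖ = ‖w‖ := by
  refine le_antisymm ((ContinuousMap.norm_le _ (norm_nonneg _)).2 fun t => le_rfl) ?_
  exact (ContinuousMap.const I w).norm_coe_le_norm 0

theorem IsQuadraticField.eq_of_fixed {f : C(V × V, V)} {C : ℝ}
    (hf : IsQuadraticField f C) {ρ : ℝ} (hρ : C * ρ ≤ 1 / 4) {u w : V} {v v' : C(I, V)}
    (hv : ‖v‖ ≤ ρ) (hv' : ‖v'‖ ≤ ρ) (h : picardMap f u w v = v) (h' : picardMap f u w v' = v') :
    v = v' := by
  have := hf.norm_picardMap_sub_le (hf.le_one hρ) u w w hv hv'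
  rw [h, h', sub_self] at this
  have h0 : ContinuousMap.const I (0 : V) = 0 := rfl
  rw [h0, sub_zero] at this
  rw [← sub_eq_zero, ← norm_le_zero_iff]
  nlinarith [norm_nonneg (v - v')]

theorem IsQuadraticField.exists_fixed [CompleteSpace V] {f : C(V × V, V)} {C : ℝ}
    (hf : IsQuadraticField f C) {ρ : ℝ} (hρ : C * ρ ≤ 1 / 4) (u : V) {w : V} (hw : ‖w‖ ≤ ρ / 2) :
    ∃ v : C(I, V), ‖v‖ ≤ ρ ∧ picardMap f u w v = v := by
  have hρ0 : 0 ≤ ρ := by linarith [norm_nonneg w]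
  have hmaps : MapsTo (picardMap f u w) (Metric.closedBall 0 ρ) (Metric.closedBall 0 ρ) := by
    intro v hv
    -- The ball is invariant because ρ/2 + Cρ² ≤ ρ/2 + ρ/4.
    rw [mem_closedBall_zero_iff] at hv ⊢
    refine (norm_add_le _ _).trans ?_
    have h1 := (norm_volterra_le _).trans (hf.norm_superposition_le u v)
    rw [norm_const_unitInterval]
    have h2 : C * ‖v‖ ^ 2 ≤ C * ρ ^ 2 := by have := hf.nonneg; gcongr
    nlinarith
  have hcontr : ContractingWith (1 / 4) (hmaps.restrict (picardMap f u w) _ _) := by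
    refine ⟨by rw [← NNReal.coe_lt_coe]; norm_num, LipschitzWith.of_dist_le_mul fun v v' => ?_⟩
    have := hf.norm_picardMap_sub_le (hf.le_one hρ) u w w (mem_closedBall_zero_iff.1 v.2)
      (mem_closedBall_zero_iff.1 v'.2)
    rw [sub_self] at this
    have h0 : ContinuousMap.const I (0 : V) = 0 := rfl
    rw [h0, sub_zero] at this
    rw [Subtype.dist_eq, Subtype.dist_eq, dist_eq_norm, dist_eq_norm]
    refine this.trans ?_
    gcongr
    simpa using hρ
  obtain ⟨v, hv, hfix, -⟩ := hcontr.exists_fixedPoint' (x := 0)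
    Metric.isClosed_closedBall.isComplete hmaps (Metric.mem_closedBall_self hρ0)
    (edist_ne_top _ _)
  exact ⟨v, mem_closedBall_zero_iff.1 hv, hfix⟩

open Classical in
/-- The velocity of the solution of `γ'' = f (γ, γ')` with initial position `u` and initial
velocity `w`, as the fixed point of `picardMap` in the ball of radius `ρ`. -/
noncomputable def velocityPath (f : C(V × V, V)) (ρ : ℝ) (u w : V) : C(I, V) :=
  if h : ∃ v : C(I, V), ‖v‖ ≤ ρ ∧ picardMap f u w v = v then h.choose else 0

/-- The solution at time one. -/
noncomputable def timeOneMap (f : C(V × V, V)) (ρ : ℝ) (u w : V) : V :=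
  u + volterra V (velocityPath f ρ u w) 1

variable [CompleteSpace V] {f : C(V × V, V)} {C ρ : ℝ} {u w w' : V}

namespace IsQuadraticField

theorem velocityPath_spec (hf : IsQuadraticField f C) (hρ : C * ρ ≤ 1 / 4) (hw : ‖w‖ ≤ ρ / 2) :
    ‖velocityPath f ρ u w‖ ≤ ρ ∧
      picardMap f u w (velocityPath f ρ u w) = velocityPath f ρ u w := by
  have h := hf.exists_fixed hρ u hw
  rw [velocityPath, dif_pos h]
  exact h.choose_spec

theorem eq_velocityPath (hf : IsQuadraticField f C) (hρ : C * ρ ≤ 1 / 4) (hw : ‖w‖ ≤ ρ / 2)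
    {v : C(I, V)} (hv : ‖v‖ ≤ ρ) (h : picardMap f u w v = v) : v = velocityPath f ρ u w :=
  have h' := hf.velocityPath_spec (u := u) hρ hw
  hf.eq_of_fixed hρ hv h'.1 h h'.2

/-- The fixed point satisfies ‖v‖ ≤ ‖w‖ + C‖v‖² with C‖v‖ ≤ 1/4; absorbing the quadratic term leaves
the factor 4/3. -/
theorem norm_velocityPath_le (hf : IsQuadraticField f C) (hρ : C * ρ ≤ 1 / 4)
    (hw : ‖w‖ ≤ ρ / 2) : ‖velocityPath f ρ u w‖ ≤ 4 / 3 * ‖w‖ := by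
  obtain ⟨h1, h2⟩ := hf.velocityPath_spec (u := u) hρ hw
  set v := velocityPath f ρ u w
  have h3 : ‖v‖ ≤ ‖w‖ + C * ‖v‖ ^ 2 := by
    conv_lhs => rw [← h2]
    refine (norm_add_le _ _).trans ?_
    rw [norm_const_unitInterval]
    gcongr
    exact (norm_volterra_le _).trans (hf.norm_superposition_le u v)
  have h4 : C * ‖v‖ ^ 2 ≤ 1 / 4 * ‖v‖ := by
    have : C * ‖v‖ ≤ 1 / 4 := le_trans (by have := hf.nonneg; gcongr) hρ
    nlinarith [norm_nonneg v]
  linarith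

theorem norm_velocityPath_sub_le (hf : IsQuadraticField f C) (hρ : C * ρ ≤ 1 / 4)
    (hw : ‖w‖ ≤ ρ / 2) (t : I) : ‖velocityPath f ρ u w t - w‖ ≤ 1 / 3 * ‖w‖ := by
  obtain ⟨h1, h2⟩ := hf.velocityPath_spec (u := u) hρ hw
  have h5 := hf.norm_velocityPath_le (u := u) hρ hw
  set v := velocityPath f ρ u w
  have h3 : v t - w = volterra V (superposition I f (phasePath u v)) t := by
    conv_lhs => rw [← h2]
    simp [picardMap]
  rw [h3]
  refine (ContinuousMap.norm_coe_le_norm _ t).trans ((norm_volterra_le _).trans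
    ((hf.norm_superposition_le u v).trans ?_))
  have : C * ‖v‖ ≤ 1 / 4 := le_trans (by have := hf.nonneg; gcongr) hρ
  nlinarith [norm_nonneg v]

/-- The velocity deviates from w by at most ‖w‖/3, so the path stays away from zero velocity, where
f need not be smooth. This is what makes smooth dependence on w ≠ 0 possible. -/
theorem le_norm_velocityPath (hf : IsQuadraticField f C) (hρ : C * ρ ≤ 1 / 4)
    (hw : ‖w‖ ≤ ρ / 2) (t : I) : 1 / 2 * ‖w‖ ≤ ‖velocityPath f ρ u w t‖ := by
  have h1 := hf.norm_velocityPath_sub_le (u := u) hρ hw t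
  have h2 := norm_sub_norm_le w (velocityPath f ρ u w t)
  rw [norm_sub_rev] at h2
  linarith [norm_nonneg w]

theorem velocityPath_zero_right (hf : IsQuadraticField f C) (hρ : C * ρ ≤ 1 / 4)
    (hρ0 : 0 ≤ ρ) : velocityPath f ρ u 0 = 0 := by
  have := hf.norm_velocityPath_le (u := u) (w := 0) hρ
    (by rw [norm_zero]; positivity)
  rw [norm_zero, mul_zero] at this
  exact norm_le_zero_iff.1 this

theorem velocityPath_apply_zero (hf : IsQuadraticField f C) (hρ : C * ρ ≤ 1 / 4)
    (hw : ‖w‖ ≤ ρ / 2) : velocityPath f ρ u w 0 = w := by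
  have h2 := (hf.velocityPath_spec (u := u) hρ hw).2
  rw [← h2]
  simp [picardMap, volterra_zero]

/-- Both velocities are at most 4s/3, and on that slab f has Lipschitz constant 4Cs/3. The bound is
linear in s, so the deviation from the identity has a Lipschitz constant tending to 0 at the zero
vector. -/
theorem norm_velocityPath_sub_sub_le (hf : IsQuadraticField f C) (hρ : C * ρ ≤ 1 / 4)
    {s : ℝ} (hs : s ≤ ρ / 2) (hw : ‖w‖ ≤ s) (hw' : ‖w'‖ ≤ s) :
    ‖velocityPath f ρ u w - velocityPath f ρ u w' - ContinuousMap.const I (w - w')‖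
      ≤ 2 * C * s * ‖w - w'‖ := by
  have h2 := (hf.velocityPath_spec (u := u) hρ (hw.trans hs)).2
  have h2' := (hf.velocityPath_spec (u := u) hρ (hw'.trans hs)).2
  have h3 := hf.norm_velocityPath_le (u := u) hρ (hw.trans hs)
  have h3' := hf.norm_velocityPath_le (u := u) hρ (hw'.trans hs)
  set v := velocityPath f ρ u w
  set v' := velocityPath f ρ u w'
  have h4 := hf.norm_picardMap_sub_le (ρ := 4 / 3 * s)
    (by linarith [hf.le_one hρ]) u w w' (v := v) (v' := v')
    (by linarith) (by linarith)
  rw [h2, h2'] at h4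
  have h5 : ‖v - v'‖ ≤ ‖v - v' - ContinuousMap.const I (w - w')‖ + ‖w - w'‖ := by
    rw [← norm_const_unitInterval (w - w')]
    simpa using norm_add_le (v - v' - ContinuousMap.const I (w - w'))
      (ContinuousMap.const I (w - w'))
  have hs0 : 0 ≤ s := (norm_nonneg _).trans hw
  have hC := hf.nonneg
  have h6 : C * s ≤ 1 / 8 := by nlinarith
  have h7 : 0 ≤ C * s := by positivity
  set N := ‖v - v' - ContinuousMap.const I (w - w')‖
  have h8 : C * s * ‖v - v'‖ ≤ 1 / 8 * ‖v - v'‖ := by gcongr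
  -- From N ≤ (4/3)(1/8)‖v - v'‖ and ‖v - v'‖ ≤ N + ‖w - w'‖ comes the factor 6/5; then (4/3)(6/5) =
  -- 8/5 ≤ 2.
  have h9 : C * s * ‖v - v'‖ ≤ C * s * (6 / 5 * ‖w - w'‖) := by gcongr; linarith
  have h10 : 0 ≤ C * s * ‖w - w'‖ := by positivity
  linarith

theorem norm_timeOneMap_sub_sub_le (hf : IsQuadraticField f C) (hρ : C * ρ ≤ 1 / 4)
    {s : ℝ} (hs : s ≤ ρ / 2) (hw : ‖w‖ ≤ s) (hw' : ‖w'‖ ≤ s) :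
    ‖timeOneMap f ρ u w - timeOneMap f ρ u w' - (w - w')‖ ≤ 2 * C * s * ‖w - w'‖ := by
  have h := hf.norm_velocityPath_sub_sub_le (u := u) hρ hs hw hw'
  refine le_trans ?_ h
  have h1 : timeOneMap f ρ u w - timeOneMap f ρ u w' - (w - w') =
      volterra V (velocityPath f ρ u w - velocityPath f ρ u w' -
        ContinuousMap.const I (w - w')) 1 := by
    have : volterra V (ContinuousMap.const I (w - w')) 1 = w - w' := by
      rw [volterra_apply]
      have : extendPath (ContinuousMap.const I (w - w')) = fun _ => w - w' := rfl
      rw [this]; simp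
    rw [map_sub, map_sub, ContinuousMap.sub_apply, this]
    simp [timeOneMap]
  rw [h1]
  exact (ContinuousMap.norm_coe_le_norm _ _).trans (norm_volterra_le _)

theorem timeOneMap_zero_right (hf : IsQuadraticField f C) (hρ : C * ρ ≤ 1 / 4)
    (hρ0 : 0 ≤ ρ) : timeOneMap f ρ u 0 = u := by
  rw [timeOneMap, hf.velocityPath_zero_right hρ hρ0, map_zero]; simp

theorem hasDerivWithinAt_position (f : C(V × V, V)) (ρ : ℝ) (u w : V) {t : ℝ}
    (ht : t ∈ Icc (0 : ℝ) 1) :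
    HasDerivWithinAt (fun s => u + extendPath (volterra V (velocityPath f ρ u w)) s)
      (extendPath (velocityPath f ρ u w) t) (Icc 0 1) t := by
  rw [extendPath_of_mem _ ht]
  exact (hasDerivWithinAt_extendPath_volterra _ ht).const_add u

theorem hasDerivWithinAt_velocityPath (hf : IsQuadraticField f C) (hρ : C * ρ ≤ 1 / 4)
    (hw : ‖w‖ ≤ ρ / 2) {t : ℝ} (ht : t ∈ Icc (0 : ℝ) 1) :
    HasDerivWithinAt (extendPath (velocityPath f ρ u w))
      (f (u + extendPath (volterra V (velocityPath f ρ u w)) t,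
        extendPath (velocityPath f ρ u w) t)) (Icc 0 1) t := by
  have h2 := (hf.velocityPath_spec (u := u) hρ hw).2
  set v := velocityPath f ρ u w
  have h := (hasDerivWithinAt_extendPath_volterra
    (superposition I f (phasePath u v)) ht).const_add w
  rw [extendPath_of_mem _ ht, extendPath_of_mem _ ht]
  refine h.congr (fun s hs => ?_) ?_
  · rw [extendPath_of_mem _ hs, extendPath_of_mem _ hs]
    conv_lhs => rw [← h2]
    rfl
  · rw [extendPath_of_mem _ ht, extendPath_of_mem _ ht]
    conv_lhs => rw [← h2]
    rfl

/-- By homogeneity of degree two, slowing a solution down by the factor a gives a solution with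
initial velocity a • w, and small fixed points are unique. The condition a ≤ 1 keeps a * t in the
unit interval. -/
theorem velocityPath_smul (hf : IsQuadraticField f C) (hρ : C * ρ ≤ 1 / 4)
    (hw : ‖w‖ ≤ ρ / 2) {a : ℝ} (ha : 0 < a) (ha1 : a ≤ 1) :
    (∀ t ∈ Icc (0 : ℝ) 1, extendPath (velocityPath f ρ u (a • w)) t =
      a • extendPath (velocityPath f ρ u w) (a * t)) ∧
    ∀ t ∈ Icc (0 : ℝ) 1, extendPath (volterra V (velocityPath f ρ u (a • w))) t =
      extendPath (volterra V (velocityPath f ρ u w)) (a * t) := by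
  obtain ⟨h1, h2⟩ := hf.velocityPath_spec (u := u) hρ hw
  set v := velocityPath f ρ u w with hv
  have hmem : ∀ t ∈ Icc (0 : ℝ) 1, a * t ∈ Icc (0 : ℝ) 1 := fun t ht =>
    ⟨mul_nonneg ha.le ht.1, mul_le_one₀ ha1 ht.1 ht.2⟩
  have hint : ∀ (b : C(I, V)) (t : I), ∫ s in (0 : ℝ)..t, a • extendPath b (a * s) =
      volterra V b ⟨a * t, hmem t t.2⟩ := by
    intro b t
    rw [intervalIntegral.integral_smul, intervalIntegral.smul_integral_comp_mul_left, mul_zero,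
      volterra_apply]
  let v' : C(I, V) := ⟨fun t => a • extendPath v (a * t),
    continuous_const.smul ((continuous_extendPath v).comp (by fun_prop))⟩
  have hv' : ∀ t ∈ Icc (0 : ℝ) 1, extendPath v' t = a • extendPath v (a * t) := fun t ht => by
    rw [extendPath_of_mem _ ht]; rfl
  have hvolt : ∀ t : I, volterra V v' t = volterra V v ⟨a * t, hmem t t.2⟩ := by
    intro t
    rw [← hint, volterra_apply]
    refine intervalIntegral.integral_congr fun s hs => hv' s ?_
    rw [uIcc_of_le t.2.1] at hs
    exact ⟨hs.1, hs.2.trans t.2.2⟩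
  have hfix : picardMap f u (a • w) v' = v' := by
    ext t
    have e1 : v' t = a • v ⟨a * t, hmem t t.2⟩ := by
      change a • extendPath v (a * t) = _
      rw [extendPath_of_mem _ (hmem t t.2)]
    have e2 : v ⟨a * t, hmem t t.2⟩ = w +
        volterra V (superposition I f (phasePath u v)) ⟨a * t, hmem t t.2⟩ := by
      conv_lhs => rw [← h2]
      rfl
    rw [e1, e2, smul_add, ← hint, ← intervalIntegral.integral_smul]
    change a • w + volterra V _ t = _
    rw [volterra_apply]
    congr 1
    refine intervalIntegral.integral_congr fun s hs => ?_
    rw [uIcc_of_le t.2.1] at hs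
    have hs' : s ∈ Icc (0 : ℝ) 1 := ⟨hs.1, hs.2.trans t.2.2⟩
    rw [extendPath_of_mem _ hs', extendPath_of_mem _ (hmem s hs'), smul_smul, ← pow_two]
    rw [superposition_apply, superposition_apply, phasePath_apply, phasePath_apply,
      ← hf.homogeneous _ _ _ ha, hvolt]
    congr 2
    change a • extendPath v (a * s) = _
    rw [extendPath_of_mem _ (hmem s hs')]
  have hnorm : ‖v'‖ ≤ ρ := by
    refine (ContinuousMap.norm_le _ ((norm_nonneg _).trans h1)).2 fun t => ?_
    change ‖a • extendPath v (a * t)‖ ≤ ρ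
    rw [norm_smul, Real.norm_of_nonneg ha.le]
    nlinarith [norm_extendPath_le v (a * t), norm_nonneg (extendPath v (a * t))]
  have hw' : ‖a • w‖ ≤ ρ / 2 := by
    rw [norm_smul, Real.norm_of_nonneg ha.le]
    nlinarith [norm_nonneg w]
  rw [← hf.eq_velocityPath hρ hw' hnorm hfix]
  refine ⟨fun t ht => hv' t ht, fun t ht => ?_⟩
  rw [extendPath_of_mem _ ht, extendPath_of_mem _ (hmem t ht), hvolt]

theorem timeOneMap_smul (hf : IsQuadraticField f C) (hρ : C * ρ ≤ 1 / 4)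
    (hw : ‖w‖ ≤ ρ / 2) {a : ℝ} (ha : a ∈ Icc (0 : ℝ) 1) :
    timeOneMap f ρ u (a • w) = u + extendPath (volterra V (velocityPath f ρ u w)) a := by
  rcases ha.1.eq_or_lt with rfl | h0
  · rw [zero_smul, hf.timeOneMap_zero_right hρ (by linarith [norm_nonneg w]),
      extendPath_of_mem _ ha]
    exact (add_zero u).symm.trans (congrArg _ (volterra_zero _).symm)
  · have := (hf.velocityPath_smul (u := u) hρ hw h0 ha.2).2 1 (by simp)
    rw [mul_one, extendPath_of_mem _ (by simp)] at this
    rw [← this]; rfl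

end IsQuadraticField

end QuadraticField

/-! ### Regularity and invertibility of the time one map -/

section SmoothDependence

open scoped unitInterval

universe u

variable {V : Type u} [NormedAddCommGroup V] [NormedSpace ℝ V]

theorem contDiff_phasePath (u : V) : ContDiff ℝ ∞ (phasePath u) := by
  have : phasePath u = fun v => (ContinuousMap.const I (u, (0 : V)) : C(I, V × V)) +
      ((ContinuousLinearMap.inl ℝ V V).compLeftContinuous ℝ I (volterra V v) +
        (ContinuousLinearMap.inr ℝ V V).compLeftContinuous ℝ I v) := by
    ext v t <;> simp
  rw [this]
  fun_prop

variable {f : C(V × V, V)} {C ρ : ℝ} {u w : V}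

namespace IsQuadraticField

/-- A field that is smooth off zero velocity can be replaced by a globally smooth one without
changing it at large velocities. -/
theorem exists_smooth_eq [FiniteDimensional ℝ V] (hf : IsQuadraticField f C) {r : ℝ}
    (hr : 0 < r) :
    ∃ g : C(V × V, V), ContDiff ℝ ∞ g ∧ ∀ z : V × V, r ≤ ‖z.2‖ → g z = f z := by
  let χ : ContDiffBump (0 : V) := ⟨r / 2, r, by positivity, by linarith⟩
  have hsm : ContDiff ℝ ∞ (fun z : V × V => (1 - χ z.2) • f z) := by
    rw [contDiff_iff_contDiffAt]
    intro z
    by_cases hz : z.2 = 0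
    · have : (fun z : V × V => (1 - χ z.2) • f z) =ᶠ[𝓝 z] fun _ => 0 := by
        have hball : {y : V × V | y.2 ∈ Metric.closedBall (0 : V) (r / 2)} ∈ 𝓝 z := by
          refine continuous_snd.continuousAt.preimage_mem_nhds ?_
          rw [hz]
          exact Metric.closedBall_mem_nhds _ (by positivity)
        filter_upwards [hball] with y hy
        rw [χ.one_of_mem_closedBall hy, sub_self, zero_smul]
      exact contDiffAt_const.congr_of_eventuallyEq this
    · have hopen : IsOpen {z : V × V | z.2 ≠ 0} := isOpen_ne_fun continuous_snd continuous_const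
      have h1 := hf.smooth.contDiffAt (hopen.mem_nhds hz)
      have h2 : ContDiffAt ℝ ∞ (fun z : V × V => χ z.2) z :=
        (χ.contDiff (n := ⊤)).contDiffAt.comp z contDiffAt_snd
      exact (contDiffAt_const.sub h2).smul h1
  refine ⟨⟨_, hsm.continuous⟩, hsm, fun z hz => ?_⟩
  change (1 - χ z.2) • f z = f z
  rw [χ.zero_of_le_dist (by simpa using hz), sub_zero, one_smul]

/-- Implicit function theorem for v - w - ∫ g(u + ∫v, v) = 0 in C([0,1], V), where g is a globally
smooth field that agrees with f at the velocities in play. -/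
theorem contDiffAt_velocityPath [FiniteDimensional ℝ V] (hf : IsQuadraticField f C)
    (hρ : C * ρ ≤ 1 / 4) (hw : ‖w‖ < ρ / 2) (hw0 : w ≠ 0) :
    ContDiffAt ℝ ∞ (velocityPath f ρ u) w := by
  have : CompleteSpace V := FiniteDimensional.complete ℝ V
  have hwpos : 0 < ‖w‖ := norm_pos_iff.2 hw0
  -- The path at w has velocity at least ‖w‖/2, so any path within ‖w‖/4 of it stays where g = f.
  obtain ⟨g, hg, hgf⟩ := hf.exists_smooth_eq (r := 1 / 4 * ‖w‖) (by positivity)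
  obtain ⟨hv1, hv2⟩ := hf.velocityPath_spec (u := u) hρ hw.le
  have hv3 := hf.norm_velocityPath_le (u := u) hρ hw.le
  have hv4 := hf.le_norm_velocityPath (u := u) hρ hw.le
  set v₀ := velocityPath f ρ u w with hv₀
  have hgood : ∀ᶠ v in 𝓝 v₀, ‖v‖ ≤ ρ ∧
      superposition I g (phasePath u v) = superposition I f (phasePath u v) := by
    have h1 : ∀ᶠ v in 𝓝 v₀, ‖v‖ < ρ :=
      continuous_norm.continuousAt.eventually (Iio_mem_nhds (by linarith))
    have h2 : ∀ᶠ v in 𝓝 v₀, ‖v - v₀‖ < 1 / 4 * ‖w‖ := by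
      have : Continuous fun v : C(I, V) => ‖v - v₀‖ := by fun_prop
      refine this.continuousAt.eventually (Iio_mem_nhds ?_)
      simpa using hw0
    filter_upwards [h1, h2] with v h1 h2
    refine ⟨h1.le, ?_⟩
    ext t
    refine hgf _ ?_
    have h3 := (v - v₀).norm_coe_le_norm t
    have h4 := norm_sub_norm_le (v₀ t) (v t)
    rw [norm_sub_rev] at h4
    have h5 := hv4 t
    rw [ContinuousMap.sub_apply] at h3
    rw [phasePath_apply]
    linarith
  have hconst : ContDiff ℝ ∞ fun p : V × C(I, V) => ContinuousMap.const I p.1 := by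
    have : (fun p : V × C(I, V) => ContinuousMap.const I p.1) =
        fun p => (ContinuousLinearMap.const ℝ I : V →L[ℝ] C(I, V)) p.1 := rfl
    rw [this]; fun_prop
  have hQ : ContDiff ℝ ∞ fun v => volterra V (superposition I g (phasePath u v)) :=
    (volterra V).contDiff.comp ((contDiff_superposition g hg).comp (contDiff_phasePath u))
  let Φ : V × C(I, V) → C(I, V) := fun p =>
    p.2 - ContinuousMap.const I p.1 - volterra V (superposition I g (phasePath u p.2))
  have hΦ : ContDiff ℝ ∞ Φ := (contDiff_snd.sub hconst).sub (hQ.comp contDiff_snd)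
  let D := fderiv ℝ (fun v => volterra V (superposition I g (phasePath u v))) v₀
  -- The bound comes from the Lipschitz constant Cρ of f, which g inherits near v₀; hence 1 - D is
  -- invertible by a Neumann series.
  have hD : ‖D‖ ≤ 1 / 4 := by
    refine norm_fderiv_le_of_lip' ℝ (by norm_num) ?_
    filter_upwards [hgood] with v hv
    rw [← map_sub, hv.2, hgood.self_of_nhds.2]
    refine (norm_volterra_le _).trans
      ((hf.norm_superposition_sub_le (hf.le_one hρ) u hv.1 hv1).trans ?_)
    gcongr
  have hder : fderiv ℝ Φ (w, v₀) ∘L .inr ℝ V C(I, V) = 1 - D := by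
    have h1 : HasFDerivAt (fun v => Φ (w, v)) (fderiv ℝ Φ (w, v₀) ∘L .inr ℝ V C(I, V)) v₀ :=
      ((hΦ.differentiable (by simp)) (w, v₀)).hasFDerivAt.comp v₀ (hasFDerivAt_prodMk_right w v₀)
    have h2 : HasFDerivAt (fun v => Φ (w, v)) (1 - D) v₀ :=
      ((hasFDerivAt_id v₀).sub_const (ContinuousMap.const I w)).fun_sub
        ((hQ.differentiable (by simp)) v₀).hasFDerivAt
    exact h1.unique h2
  have hinv : (fderiv ℝ Φ (w, v₀) ∘L .inr ℝ V C(I, V)).IsInvertible := by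
    rw [hder]
    refine ⟨ContinuousLinearEquiv.unitsEquiv ℝ _ (Units.oneSub D (by linarith)), ?_⟩
    ext v
    simp
  have hΦat := hΦ.contDiffAt (x := (w, v₀))
  have hzero : Φ (w, v₀) = 0 := by
    have : v₀ = ContinuousMap.const I w + volterra V (superposition I f (phasePath u v₀)) :=
      hv2.symm
    simp only [Φ]
    rw [hgood.self_of_nhds.2, sub_sub, ← this, sub_self]
  have hne : (∞ : ℕ∞ω) ≠ 0 := by simp
  refine (hΦat.contDiffAt_implicitFunction hne hinv).congr_of_eventuallyEq ?_
  have hcont : Filter.Tendsto (hΦat.implicitFunction hne hinv) (𝓝 w) (𝓝 v₀) := by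
    have := (hΦat.contDiffAt_implicitFunction hne hinv).continuousAt
    rwa [ContinuousAt, hΦat.implicitFunction_apply_self hne hinv] at this
  have hnear : ∀ᶠ w' in 𝓝 w, ‖w'‖ < ρ / 2 :=
    continuous_norm.continuousAt.eventually (Iio_mem_nhds hw)
  filter_upwards [hcont.eventually hgood, hΦat.eventually_apply_implicitFunction hne hinv,
    hnear] with w' h1 h2 h3
  -- The implicit function is a fixed point of the original Picard map in the ball of radius ρ,
  -- hence is `velocityPath` by uniqueness.
  symm
  refine hf.eq_velocityPath hρ h3.le h1.1 ?_
  rw [hzero] at h2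
  simp only [Φ] at h2
  rw [h1.2, sub_sub, sub_eq_zero] at h2
  exact h2.symm

theorem contDiffAt_timeOneMap [FiniteDimensional ℝ V] (hf : IsQuadraticField f C)
    (hρ : C * ρ ≤ 1 / 4) (hw : ‖w‖ < ρ / 2) (hw0 : w ≠ 0) :
    ContDiffAt ℝ ∞ (timeOneMap f ρ u) w := by
  have h : timeOneMap f ρ u = fun w => u +
      ((ContinuousMap.evalCLM ℝ (1 : I)).comp (volterra V)) (velocityPath f ρ u w) := rfl
  rw [h]
  exact contDiffAt_const.add
    ((ContinuousLinearMap.contDiff _).contDiffAt.comp w (hf.contDiffAt_velocityPath hρ hw hw0))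

theorem hasFDerivAt_timeOneMap_zero [CompleteSpace V] (hf : IsQuadraticField f C)
    (hρ : C * ρ ≤ 1 / 4) (hρ0 : 0 < ρ) :
    HasFDerivAt (timeOneMap f ρ u) (ContinuousLinearMap.id ℝ V) 0 := by
  rw [hasFDerivAt_iff_isLittleO, Asymptotics.isLittleO_iff]
  intro c hc
  have hC := hf.nonneg
  have hs : 0 < min (ρ / 2) (c / (2 * C + 1)) := by positivity
  filter_upwards [Metric.closedBall_mem_nhds (0 : V) hs] with w hw
  rw [mem_closedBall_zero_iff] at hw
  refine (hf.norm_timeOneMap_sub_sub_le hρ (min_le_left _ _) hw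
    (by rw [norm_zero]; exact hs.le)).trans ?_
  gcongr
  have h1 : min (ρ / 2) (c / (2 * C + 1)) ≤ c / (2 * C + 1) := min_le_right _ _
  rw [le_div_iff₀ (by positivity)] at h1
  nlinarith

theorem differentiableAt_timeOneMap [FiniteDimensional ℝ V] (hf : IsQuadraticField f C)
    (hρ : C * ρ ≤ 1 / 4) (hw : ‖w‖ < ρ / 2) : DifferentiableAt ℝ (timeOneMap f ρ u) w := by
  have : CompleteSpace V := FiniteDimensional.complete ℝ V
  by_cases hw0 : w = 0
  · rw [hw0]
    exact (hf.hasFDerivAt_timeOneMap_zero hρ (by linarith [norm_nonneg w])).differentiableAt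
  · exact (hf.contDiffAt_timeOneMap hρ hw hw0).differentiableAt (by simp)

theorem norm_fderiv_timeOneMap_sub_id_le [FiniteDimensional ℝ V] (hf : IsQuadraticField f C)
    (hρ : C * ρ ≤ 1 / 4) {s : ℝ} (hs : s ≤ ρ / 2) (hw : ‖w‖ < s) :
    ‖fderiv ℝ (timeOneMap f ρ u) w - ContinuousLinearMap.id ℝ V‖ ≤ 2 * C * s := by
  have : CompleteSpace V := FiniteDimensional.complete ℝ V
  have hC := hf.nonneg
  have hs0 : 0 ≤ s := (norm_nonneg w).trans hw.le
  have h := (hf.differentiableAt_timeOneMap (u := u) hρ (hw.trans_le hs)).hasFDerivAt.sub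
    (hasFDerivAt_id w)
  rw [← h.fderiv]
  refine norm_fderiv_le_of_lip' ℝ (by positivity) ?_
  have hnear : ∀ᶠ w' in 𝓝 w, ‖w'‖ < s :=
    continuous_norm.continuousAt.eventually (Iio_mem_nhds hw)
  filter_upwards [hnear] with w' hw'
  refine le_trans (le_of_eq ?_) (hf.norm_timeOneMap_sub_sub_le (u := u) hρ hs hw'.le hw.le)
  congr 1
  simp only [id, Pi.sub_apply]
  abel

/-- Only w = 0 needs an argument: on the ball of radius s the derivative is within 2Cs of the
identity, which is its value at 0, so it is continuous there. -/
theorem contDiffAt_one_timeOneMap [FiniteDimensional ℝ V] (hf : IsQuadraticField f C)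
    (hρ : C * ρ ≤ 1 / 4) (hw : ‖w‖ < ρ / 2) : ContDiffAt ℝ 1 (timeOneMap f ρ u) w := by
  have : CompleteSpace V := FiniteDimensional.complete ℝ V
  by_cases hw0 : w = 0
  swap
  · exact (hf.contDiffAt_timeOneMap hρ hw hw0).of_le (by exact_mod_cast le_top)
  subst hw0
  rw [norm_zero] at hw
  have hC := hf.nonneg
  refine contDiffAt_one_iff.2 ⟨fderiv ℝ (timeOneMap f ρ u), Metric.ball 0 (ρ / 2),
    Metric.ball_mem_nhds _ hw, fun w hw => ContinuousAt.continuousWithinAt ?_, fun w hw =>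
      (hf.differentiableAt_timeOneMap hρ (mem_ball_zero_iff.1 hw)).hasFDerivAt⟩
  rw [mem_ball_zero_iff] at hw
  by_cases hw0 : w = 0
  · subst hw0
    rw [Metric.continuousAt_iff]
    intro ε hε
    have hs : 0 < min (ρ / 2) (ε / (2 * C + 1)) := by
      rw [norm_zero] at hw
      positivity
    refine ⟨_, hs, fun {w} hw => ?_⟩
    rw [dist_zero_right] at hw
    rw [(hf.hasFDerivAt_timeOneMap_zero hρ (by linarith)).fderiv, dist_eq_norm]
    refine (hf.norm_fderiv_timeOneMap_sub_id_le hρ (min_le_left _ _) hw).trans_lt ?_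
    have h1 : min (ρ / 2) (ε / (2 * C + 1)) ≤ ε / (2 * C + 1) := min_le_right _ _
    rw [le_div_iff₀ (by positivity)] at h1
    nlinarith
  · exact ((hf.contDiffAt_timeOneMap hρ hw hw0).fderiv_right (m := 0) (by simp)).continuousAt

theorem approximatesLinearOn_timeOneMap [CompleteSpace V] (hf : IsQuadraticField f C)
    (hρ : C * ρ ≤ 1 / 4) :
    ApproximatesLinearOn (timeOneMap f ρ u)
      ((ContinuousLinearEquiv.refl ℝ V : V ≃L[ℝ] V) : V →L[ℝ] V) (Metric.ball 0 (ρ / 2))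
      (1 / 4) := by
  intro w hw w' hw'
  rw [mem_ball_zero_iff] at hw hw'
  refine (hf.norm_timeOneMap_sub_sub_le hρ le_rfl hw.le hw'.le).trans ?_
  gcongr
  push_cast
  linarith

/-- The time one map as an open partial homeomorphism. -/
theorem exists_openPartialHomeomorph [FiniteDimensional ℝ V] (hf : IsQuadraticField f C)
    (hρ : C * ρ ≤ 1 / 4) :
    ∃ φ : OpenPartialHomeomorph V V, ⇑φ = timeOneMap f ρ u ∧
      φ.source = Metric.ball 0 (ρ / 2) ∧
      (∀ z ∈ φ.target, ContDiffAt ℝ 1 φ.symm z) ∧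
      (∀ z ∈ φ.target, φ.symm z ≠ 0 → ContDiffAt ℝ ∞ φ.symm z) ∧
      ∀ r, 0 ≤ r → r < ρ / 2 → Metric.closedBall u (r / 2) ⊆ φ '' Metric.closedBall 0 r := by
  have : CompleteSpace V := FiniteDimensional.complete ℝ V
  have happrox := hf.approximatesLinearOn_timeOneMap (u := u) hρ
  -- In the nontrivial case the identity has norm 1; dimension zero is separate because there the
  -- identity has norm 0.
  have hc : Subsingleton V ∨ (1 / 4 : NNReal) <
      ‖((ContinuousLinearEquiv.refl ℝ V).symm : V →L[ℝ] V)‖₊⁻¹ := by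
    rcases subsingleton_or_nontrivial V with h | h
    · exact Or.inl h
    · right
      have : ((ContinuousLinearEquiv.refl ℝ V).symm : V →L[ℝ] V) = ContinuousLinearMap.id ℝ V := rfl
      rw [this, ContinuousLinearMap.nnnorm_id, inv_one, ← NNReal.coe_lt_coe]
      norm_num
  let φ := happrox.toOpenPartialHomeomorph _ _ hc Metric.isOpen_ball
  have hsrc : φ.source = Metric.ball 0 (ρ / 2) := rfl
  have hcoe : ⇑φ = timeOneMap f ρ u := rfl
  have hderiv : ∀ w, ‖w‖ < ρ / 2 → ∃ A : V ≃L[ℝ] V,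
      HasFDerivAt (timeOneMap f ρ u) (A : V →L[ℝ] V) w := by
    intro w hw
    have h1 := hf.norm_fderiv_timeOneMap_sub_id_le (u := u) hρ le_rfl hw
    set B := fderiv ℝ (timeOneMap f ρ u) w with hB
    have h2 : ‖1 - B‖ < 1 := by
      rw [norm_sub_rev]
      exact h1.trans_lt (by linarith)
    refine ⟨ContinuousLinearEquiv.unitsEquiv ℝ _ (Units.oneSub (1 - B) h2), ?_⟩
    have h3 : ((ContinuousLinearEquiv.unitsEquiv ℝ _ (Units.oneSub (1 - B) h2) : V ≃L[ℝ] V) :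
        V →L[ℝ] V) = B := by
      ext v; simp
    rw [h3]
    exact (hf.differentiableAt_timeOneMap hρ hw).hasFDerivAt
  have hmem : ∀ z ∈ φ.target, ‖φ.symm z‖ < ρ / 2 := fun z hz => by
    have := φ.map_target hz
    rwa [hsrc, mem_ball_zero_iff] at this
  refine ⟨φ, hcoe, hsrc, fun z hz => ?_, fun z hz hz0 => ?_, fun r hr0 hr => ?_⟩
  · obtain ⟨A, hA⟩ := hderiv _ (hmem z hz)
    exact φ.contDiffAt_symm hz hA (hf.contDiffAt_one_timeOneMap hρ (hmem z hz))
  · obtain ⟨A, hA⟩ := hderiv _ (hmem z hz)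
    exact φ.contDiffAt_symm hz hA (hf.contDiffAt_timeOneMap hρ (hmem z hz) hz0)
  -- With a right inverse of norm 1 the covered radius is (1 - 1/4) r, more than r/2. It does not
  -- depend on u, which later allows moving the base point.
  · let R : ContinuousLinearMap.NonlinearRightInverse
        ((ContinuousLinearEquiv.refl ℝ V : V ≃L[ℝ] V) : V →L[ℝ] V) :=
      ⟨id, 1, fun y => by simp, fun y => rfl⟩
    have h := happrox.surjOn_closedBall_of_nonlinearRightInverse R hr0 (b := 0)
      (Metric.closedBall_subset_ball hr)
    rw [hf.timeOneMap_zero_right hρ (by linarith)] at h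
    refine (Metric.closedBall_subset_closedBall ?_).trans h
    have hR : R.nnnorm = 1 := rfl
    rw [hR]
    push_cast
    linarith

end IsQuadraticField

end SmoothDependence

/-! ### Estimates for positively homogeneous functions -/

section Homogeneous

open scoped unitInterval

variable {V W : Type*} [NormedAddCommGroup V] [NormedSpace ℝ V] [NormedAddCommGroup W]
  [NormedSpace ℝ W]

theorem eq_zero_of_homogeneous {g : V → W} {k : ℕ} (hk : k ≠ 0)
    (hom : ∀ w (a : ℝ), 0 < a → g (a • w) = a ^ k • g w) : g 0 = 0 := by
  have h := hom 0 2 two_pos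
  rw [smul_zero, eq_comm, ← sub_eq_zero] at h
  have h2 : ((2 : ℝ) ^ k - 1) • g 0 = 0 := by rw [sub_smul, one_smul]; exact h
  refine (smul_eq_zero.1 h2).resolve_left (ne_of_gt ?_)
  rw [sub_pos]
  exact one_lt_pow₀ one_lt_two hk

theorem norm_homogeneous {g : V → W} {k : ℕ}
    (hom : ∀ w (a : ℝ), 0 < a → g (a • w) = a ^ k • g w) {w : V} (hw : w ≠ 0) :
    ‖g w‖ = ‖g (‖w‖⁻¹ • w)‖ * ‖w‖ ^ k := by
  have hw' : 0 < ‖w‖ := norm_pos_iff.2 hw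
  have h := hom (‖w‖⁻¹ • w) ‖w‖ hw'
  rw [smul_smul, mul_inv_cancel₀ hw'.ne', one_smul] at h
  rw [h, norm_smul, norm_pow, norm_norm, mul_comm]

/-- Homogeneity reduces the bound to the compact set K × unit sphere, so no continuity at w = 0 is
needed. -/
theorem exists_norm_le_of_homogeneous [FiniteDimensional ℝ V] {G : V × V → W} {K : Set V}
    (hK : IsCompact K) (hG : ContinuousOn G (K ×ˢ {0}ᶜ)) {k : ℕ} (hk : k ≠ 0)
    (hom : ∀ u ∈ K, ∀ w (a : ℝ), 0 < a → G (u, a • w) = a ^ k • G (u, w)) :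
    ∃ C, 0 < C ∧ ∀ u ∈ K, ∀ w, ‖G (u, w)‖ ≤ C * ‖w‖ ^ k := by
  have : ProperSpace V := FiniteDimensional.proper ℝ V
  have hsub : K ×ˢ Metric.sphere (0 : V) 1 ⊆ K ×ˢ {0}ᶜ :=
    prod_mono_right fun w hw => Metric.ne_of_mem_sphere hw one_ne_zero
  obtain ⟨C, hC⟩ := (hK.prod (isCompact_sphere (0 : V) 1)).exists_bound_of_continuousOn
    (hG.mono hsub)
  refine ⟨max C 1, by positivity, fun u hu w => ?_⟩
  by_cases hw : w = 0
  · rw [hw, eq_zero_of_homogeneous (g := fun w => G (u, w)) hk (hom u hu), norm_zero]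
    positivity
  · rw [norm_homogeneous (g := fun w => G (u, w)) (hom u hu) hw]
    gcongr
    exact (hC _ ⟨hu, by simp [norm_smul, hw]⟩).trans (le_max_left _ _)

theorem exists_le_norm_of_homogeneous [FiniteDimensional ℝ V] {G : V × V → W} {K : Set V}
    (hK : IsCompact K) (hG : ContinuousOn G (K ×ˢ {0}ᶜ)) {k : ℕ} (hk : k ≠ 0)
    (hom : ∀ u ∈ K, ∀ w (a : ℝ), 0 < a → G (u, a • w) = a ^ k • G (u, w))
    (hne : ∀ u ∈ K, ∀ w, w ≠ 0 → G (u, w) ≠ 0) :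
    ∃ m, 0 < m ∧ ∀ u ∈ K, ∀ w, m * ‖w‖ ^ k ≤ ‖G (u, w)‖ := by
  have : ProperSpace V := FiniteDimensional.proper ℝ V
  have hsub : K ×ˢ Metric.sphere (0 : V) 1 ⊆ K ×ˢ {0}ᶜ :=
    prod_mono_right fun w hw => Metric.ne_of_mem_sphere hw one_ne_zero
  obtain ⟨m, hm0, hm⟩ := (hK.prod (isCompact_sphere (0 : V) 1)).exists_forall_le' (a := 0)
    (hG.mono hsub).norm (fun z hz => norm_pos_iff.2
      (hne z.1 hz.1 z.2 (Metric.ne_of_mem_sphere hz.2 one_ne_zero)))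
  refine ⟨m, hm0, fun u hu w => ?_⟩
  by_cases hw : w = 0
  · rw [hw, norm_zero, zero_pow hk, mul_zero]
    positivity
  · rw [norm_homogeneous (g := fun w => G (u, w)) (hom u hu) hw]
    gcongr
    exact hm _ ⟨hu, by simp [norm_smul, hw]⟩

/-- A quadratic bound uniform in nearby positions gives differentiability in both variables jointly
on the zero section, where smoothness may fail. -/
theorem hasFDerivAt_zero_of_norm_le_sq {G : V × V → W} {C : ℝ} {u : V}
    (h : ∀ᶠ u' in 𝓝 u, ∀ w, ‖G (u', w)‖ ≤ C * ‖w‖ ^ 2) :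
    HasFDerivAt G (0 : V × V →L[ℝ] W) (u, 0) := by
  have h0 : G (u, 0) = 0 := by
    have := h.self_of_nhds 0
    rw [norm_zero, zero_pow two_ne_zero, mul_zero] at this
    exact norm_le_zero_iff.1 this
  rw [hasFDerivAt_iff_isLittleO]
  have h1 : (fun z : V × V => G z - G (u, 0) - (0 : V × V →L[ℝ] W) (z - (u, 0))) =O[𝓝 (u, 0)]
      fun z => ‖z - (u, 0)‖ ^ 2 := by
    refine Asymptotics.IsBigO.of_bound |C| ?_
    filter_upwards [continuousAt_fst.eventually h] with z hz
    rw [h0, sub_zero, zero_apply, sub_zero, norm_pow, norm_norm]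
    refine (hz z.2).trans ?_
    have h3 : ‖z.2‖ ≤ ‖z - (u, 0)‖ := by
      have := norm_snd_le (z - (u, (0 : V)))
      simpa using this
    gcongr
    exact le_abs_self C
  refine h1.trans_isLittleO ?_
  have h2 : Filter.Tendsto (fun z : V × V => z - (u, 0)) (𝓝 (u, 0)) (𝓝 0) := by
    have : Continuous fun z : V × V => z - (u, 0) := by fun_prop
    simpa using this.tendsto (u, (0 : V))
  have h4 := (Asymptotics.isLittleO_norm_pow_id (E' := V × V) one_lt_two).comp_tendsto h2
  exact h4

theorem hasFDerivAt_fiberScaling (a : ℝ) (z : V × V) :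
    HasFDerivAt (fun z : V × V => (z.1, a • z.2))
      ((ContinuousLinearMap.fst ℝ V V).prod (a • ContinuousLinearMap.snd ℝ V V)) z :=
  hasFDerivAt_fst.prodMk (hasFDerivAt_snd.const_smul a)

end Homogeneous

/-! ### From a locally defined spray to a field with global estimates -/

section Cutoff

variable {V : Type*} [NormedAddCommGroup V] [NormedSpace ℝ V] [FiniteDimensional ℝ V]

/-- The position derivative is homogeneous of degree two and the velocity derivative of degree one,
so on {‖w‖ ≤ ρ} with ρ ≤ 1 both are O(ρ). Since f is differentiable at zero velocity too, the mean
value inequality applies on this convex slab. -/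
theorem isQuadraticField_of_compact_support {f : V × V → V} {K : Set V} (hK : IsCompact K)
    (hsm : ContDiffOn ℝ ∞ f {z | z.2 ≠ 0})
    (hom : ∀ u w (a : ℝ), 0 < a → f (u, a • w) = a ^ 2 • f (u, w))
    (hsupp : ∀ z : V × V, z.1 ∉ K → f z = 0) :
    ∃ (g : C(V × V, V)) (C : ℝ), ⇑g = f ∧ IsQuadraticField g C := by
  have hopen : IsOpen {z : V × V | z.2 ≠ 0} := isOpen_ne_fun continuous_snd continuous_const
  have hsub : K ×ˢ ({0}ᶜ : Set V) ⊆ {z : V × V | z.2 ≠ 0} := fun z hz => hz.2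
  obtain ⟨C₀, hC₀, hb₀⟩ := exists_norm_le_of_homogeneous hK (hsm.continuousOn.mono hsub)
    two_ne_zero fun u _ => hom u
  have hbound : ∀ z : V × V, ‖f z‖ ≤ C₀ * ‖z.2‖ ^ 2 := fun z => by
    by_cases hz : z.1 ∈ K
    · exact hb₀ z.1 hz z.2
    · rw [hsupp z hz, norm_zero]; positivity
  have hdiff : ∀ z, DifferentiableAt ℝ f z := by
    rintro ⟨u, w⟩
    by_cases hw : w = 0
    · rw [hw]
      exact (hasFDerivAt_zero_of_norm_le_sq (C := C₀)
        (Filter.Eventually.of_forall fun u' w' => hbound (u', w'))).differentiableAt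
    · exact (hsm.contDiffAt (hopen.mem_nhds hw)).differentiableAt (by simp)
  have hscale : ∀ (z : V × V) (a : ℝ), 0 < a → ∀ h k,
      fderiv ℝ f (z.1, a • z.2) (h, a • k) = a ^ 2 • fderiv ℝ f z (h, k) := by
    intro z a ha h k
    have h1 := (hdiff (z.1, a • z.2)).hasFDerivAt.comp z (hasFDerivAt_fiberScaling a z)
    have h2 := (hdiff z).hasFDerivAt.const_smul (a ^ 2)
    have h3 : f ∘ (fun z : V × V => (z.1, a • z.2)) = a ^ 2 • f := by
      ext1 y; exact hom y.1 y.2 a ha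
    rw [h3] at h1
    exact congrArg (fun A : V × V →L[ℝ] V => A (h, k)) (h1.unique h2)
  have hfcont : ContinuousOn (fderiv ℝ f) {z | z.2 ≠ 0} :=
    hsm.continuousOn_fderiv_of_isOpen hopen (by simp)
  have hsupp' : ∀ z : V × V, z.1 ∉ K → fderiv ℝ f z = 0 := by
    intro z hz
    have : f =ᶠ[𝓝 z] fun _ => 0 := by
      filter_upwards [continuousAt_fst.preimage_mem_nhds
        (hK.isClosed.isOpen_compl.mem_nhds hz)] with y hy using hsupp y hy
    rw [this.fderiv_eq]; exact fderiv_const_apply _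
  obtain ⟨C₁, hC₁, hb₁⟩ := exists_norm_le_of_homogeneous (k := 2)
    (G := fun z => fderiv ℝ f z ∘L ContinuousLinearMap.inl ℝ V V) hK
    ((hfcont.mono hsub).clm_comp continuousOn_const) two_ne_zero (by
      intro u _ w a ha
      ext h
      have := hscale (u, w) a ha h 0
      rw [smul_zero] at this
      simpa using this)
  obtain ⟨C₂, hC₂, hb₂⟩ := exists_norm_le_of_homogeneous (k := 1)
    (G := fun z => fderiv ℝ f z ∘L ContinuousLinearMap.inr ℝ V V) hK
    ((hfcont.mono hsub).clm_comp continuousOn_const) one_ne_zero (by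
      intro u _ w a ha
      ext k
      -- Rescaling the direction by a⁻¹ turns the factor a² into a, the degree of the velocity
      -- derivative.
      have h1 := hscale (u, w) a ha 0 (a⁻¹ • k)
      rw [smul_smul, mul_inv_cancel₀ ha.ne', one_smul] at h1
      have h2 : ((0 : V), a⁻¹ • k) = a⁻¹ • ((0 : V), k) := by simp
      rw [h2, map_smul, smul_smul] at h1
      simp only [ContinuousLinearMap.comp_apply, ContinuousLinearMap.inr_apply,
        smul_apply]
      rw [h1]
      congr 1
      field_simp)
  have hfd : ∀ (ρ : ℝ) (z : V × V), ρ ≤ 1 → ‖z.2‖ ≤ ρ → ‖fderiv ℝ f z‖ ≤ (C₁ + C₂) * ρ := by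
    intro ρ z hρ hz
    have hρ0 : 0 ≤ ρ := (norm_nonneg _).trans hz
    by_cases hzK : z.1 ∈ K
    · refine ContinuousLinearMap.opNorm_le_bound _ (by positivity) fun y => ?_
      have h1 := (fderiv ℝ f z ∘L ContinuousLinearMap.inl ℝ V V).le_of_opNorm_le
        (hb₁ z.1 hzK z.2) y.1
      have h2 := (fderiv ℝ f z ∘L ContinuousLinearMap.inr ℝ V V).le_of_opNorm_le
        (hb₂ z.1 hzK z.2) y.2
      have h3 : fderiv ℝ f z y = (fderiv ℝ f z ∘L ContinuousLinearMap.inl ℝ V V) y.1 +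
          (fderiv ℝ f z ∘L ContinuousLinearMap.inr ℝ V V) y.2 := by
        simp [← map_add]
      rw [h3]
      refine (norm_add_le _ _).trans ((add_le_add h1 h2).trans ?_)
      have h4 : ‖z.2‖ ^ 2 ≤ ρ := by nlinarith [norm_nonneg z.2]
      have h5 : C₁ * ‖z.2‖ ^ 2 * ‖y.1‖ ≤ C₁ * ρ * ‖y‖ := by
        gcongr; exact norm_fst_le y
      have h6 : C₂ * ‖z.2‖ ^ 1 * ‖y.2‖ ≤ C₂ * ρ * ‖y‖ := by
        rw [pow_one]; gcongr; exact norm_snd_le y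
      linarith
    · rw [hsupp' z hzK, norm_zero]; positivity
  have hcont : Continuous f := continuous_iff_continuousAt.2 fun z => (hdiff z).continuousAt
  refine ⟨⟨f, hcont⟩, max (max C₀ (C₁ + C₂)) 1, rfl, hsm, le_max_right _ _, fun z => ?_, ?_, hom⟩
  · refine (hbound z).trans ?_
    gcongr
    exact (le_max_left _ _).trans (le_max_left _ _)
  · intro ρ z z' hρ hz hz'
    have hρ0 : 0 ≤ ρ := (norm_nonneg _).trans hz
    have hconv : Convex ℝ {y : V × V | ‖y.2‖ ≤ ρ} := by
      have := (convex_closedBall (0 : V) ρ).linear_preimage (LinearMap.snd ℝ V V)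
      simpa [preimage, Metric.mem_closedBall] using this
    refine (hconv.norm_image_sub_le_of_norm_fderiv_le (fun y _ => hdiff y)
      (fun y hy => hfd ρ y hρ hy) hz' hz).trans ?_
    gcongr
    exact (le_max_right _ _).trans (le_max_left _ _)

/-- Near a given position, a homogeneous second order equation agrees with one that satisfies
global estimates. -/
theorem exists_isQuadraticField {G : V × V → V} {U : Set V} (hU : IsOpen U)
    (hsm : ContDiffOn ℝ ∞ G (U ×ˢ {0}ᶜ))
    (hom : ∀ u ∈ U, ∀ w (a : ℝ), 0 < a → G (u, a • w) = a ^ 2 • G (u, w)) {u₀ : V}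
    (hu₀ : u₀ ∈ U) :
    ∃ (f : C(V × V, V)) (C R : ℝ), IsQuadraticField f C ∧ 0 < R ∧
      Metric.closedBall u₀ R ⊆ U ∧ ∀ u ∈ Metric.closedBall u₀ R, ∀ w, f (u, w) = G (u, w) := by
  have : ProperSpace V := FiniteDimensional.proper ℝ V
  obtain ⟨R, hR, hRU⟩ := Metric.nhds_basis_closedBall.mem_iff.1 (hU.mem_nhds hu₀)
  let χ : ContDiffBump u₀ := ⟨R / 2, R, by positivity, by linarith⟩
  have hχ0 : ∀ u, u ∉ Metric.closedBall u₀ R → χ u = 0 := fun u hu =>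
    χ.zero_of_le_dist (by rw [Metric.mem_closedBall, not_le] at hu; exact hu.le)
  obtain ⟨g, C, hg, hgC⟩ := isQuadraticField_of_compact_support
    (f := fun z : V × V => χ z.1 • G z) (isCompact_closedBall u₀ R) (by
      intro z hz
      refine ContDiffAt.contDiffWithinAt ?_
      by_cases hzU : z.1 ∈ U
      · have h1 := hsm.contDiffAt
          ((hU.prod isOpen_compl_singleton).mem_nhds (show z ∈ U ×ˢ {0}ᶜ from ⟨hzU, hz⟩))
        exact ((χ.contDiff (n := ⊤)).contDiffAt.comp z contDiffAt_fst).smul h1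
      · have : (fun z : V × V => χ z.1 • G z) =ᶠ[𝓝 z] fun _ => 0 := by
          filter_upwards [continuousAt_fst.preimage_mem_nhds
            (Metric.isClosed_closedBall.isOpen_compl.mem_nhds fun h => hzU (hRU h))] with y hy
          rw [hχ0 _ hy, zero_smul]
        exact contDiffAt_const.congr_of_eventuallyEq this)
    (by
      intro u w a ha
      by_cases hu : u ∈ U
      · simp only
        rw [hom u hu w a ha, smul_comm]
      · simp only [hχ0 u fun h => hu (hRU h), zero_smul, smul_zero])
    (fun z hz => by simp only [hχ0 _ hz, zero_smul])
  refine ⟨g, C, R / 2, hgC, by positivity,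
    (Metric.closedBall_subset_closedBall (by linarith)).trans hRU, fun u hu w => ?_⟩
  rw [hg]
  simp only
  rw [χ.one_of_mem_closedBall hu, one_smul]

end Cutoff

/-! ### The Euler–Lagrange equation and its spray -/

section Lagrangian

open scoped unitInterval

variable {V : Type*} [NormedAddCommGroup V] [NormedSpace ℝ V]

theorem hasFDerivAt_slice_right {W : Type*} [NormedAddCommGroup W] [NormedSpace ℝ W]
    {G : V × V → W} {G' : V × V →L[ℝ] W} {z : V × V} (h : HasFDerivAt G G' z) :
    HasFDerivAt (fun w => G (z.1, w)) (G' ∘L ContinuousLinearMap.inr ℝ V V) z.2 :=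
  HasFDerivAt.comp (f := fun w => (z.1, w)) z.2 h (hasFDerivAt_prodMk_right z.1 z.2)

theorem hasFDerivAt_slice_left {W : Type*} [NormedAddCommGroup W] [NormedSpace ℝ W]
    {G : V × V → W} {G' : V × V →L[ℝ] W} {z : V × V} (h : HasFDerivAt G G' z) :
    HasFDerivAt (fun u => G (u, z.2)) (G' ∘L ContinuousLinearMap.inl ℝ V V) z.1 :=
  HasFDerivAt.comp (f := fun u => (u, z.2)) z.1 h (hasFDerivAt_prodMk_left z.1 z.2)

theorem hasDerivWithinAt_along_curve {W : Type*} [NormedAddCommGroup W] [NormedSpace ℝ W]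
    {G : V × V → W} {G' : V × V →L[ℝ] W} {γ ν : ℝ → V} {a b : V} {S : Set ℝ} {t : ℝ}
    (h : HasFDerivAt G G' (γ t, ν t)) (hγ : HasDerivWithinAt γ a S t)
    (hν : HasDerivWithinAt ν b S t) :
    HasDerivWithinAt (fun τ => G (γ τ, ν τ)) (G' (a, b)) S t :=
  HasFDerivAt.comp_hasDerivWithinAt (f := fun τ => (γ τ, ν τ)) t h (hγ.prodMk hν)

/-- The energy Lagrangian of a Finsler metric on an open set of a vector space. -/
structure IsFinslerLagrangian (U : Set V) (L : V → V → ℝ) : Prop where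
  isOpen : IsOpen U
  smooth : ContDiffOn ℝ ∞ (fun z : V × V => L z.1 z.2) (U ×ˢ {0}ᶜ)
  homogeneous : ∀ u ∈ U, ∀ w (a : ℝ), 0 < a → L u (a • w) = a ^ 2 * L u w
  pos : ∀ u ∈ U, ∀ w, w ≠ 0 → 0 < L u w
  posDef : ∀ u ∈ U, ∀ w, w ≠ 0 → ∀ h, h ≠ 0 → 0 < fderiv ℝ (fderiv ℝ (L u)) w h h

/-- The momentum `∂L/∂w`. -/
noncomputable def momentum (L : V → V → ℝ) (z : V × V) : V →L[ℝ] ℝ := fderiv ℝ (L z.1) z.2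

/-- The derivative `∂L/∂u` of the Lagrangian in the position. -/
noncomputable def force (L : V → V → ℝ) (z : V × V) : V →L[ℝ] ℝ :=
  fderiv ℝ (fun u => L u z.2) z.1

/-- The acceleration prescribed by the Euler-Lagrange equation. -/
noncomputable def spray (L : V → V → ℝ) (z : V × V) : V :=
  (fderiv ℝ (momentum L) z ∘L ContinuousLinearMap.inr ℝ V V).inverse
    (force L z - fderiv ℝ (momentum L) z (z.2, 0))

namespace IsFinslerLagrangian

variable {U : Set V} {L : V → V → ℝ}

theorem isOpen_prod (hL : IsFinslerLagrangian U L) : IsOpen (U ×ˢ ({0}ᶜ : Set V)) :=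
  hL.isOpen.prod isOpen_compl_singleton

theorem contDiffAt (hL : IsFinslerLagrangian U L) {z : V × V} (hz : z ∈ U ×ˢ ({0}ᶜ : Set V)) :
    ContDiffAt ℝ ∞ (fun z : V × V => L z.1 z.2) z :=
  hL.smooth.contDiffAt (hL.isOpen_prod.mem_nhds hz)

theorem hasFDerivAt_zero [FiniteDimensional ℝ V] (hL : IsFinslerLagrangian U L) {u : V}
    (hu : u ∈ U) :
    HasFDerivAt (fun z : V × V => L z.1 z.2) (0 : V × V →L[ℝ] ℝ) (u, 0) := by
  have : ProperSpace V := FiniteDimensional.proper ℝ V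
  obtain ⟨R, hR, hRU⟩ := Metric.nhds_basis_closedBall.mem_iff.1 (hL.isOpen.mem_nhds hu)
  obtain ⟨C, -, hC⟩ := exists_norm_le_of_homogeneous (G := fun z : V × V => L z.1 z.2)
    (isCompact_closedBall u R)
    (hL.smooth.continuousOn.mono (prod_mono_left hRU)) two_ne_zero
    fun u hu => hL.homogeneous u (hRU hu)
  refine hasFDerivAt_zero_of_norm_le_sq (C := C) ?_
  filter_upwards [Metric.closedBall_mem_nhds u hR] with u' hu' using hC u' hu'

theorem differentiableAt [FiniteDimensional ℝ V] (hL : IsFinslerLagrangian U L) {z : V × V}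
    (hz : z.1 ∈ U) : DifferentiableAt ℝ (fun z : V × V => L z.1 z.2) z := by
  by_cases hz2 : z.2 = 0
  · obtain ⟨u, w⟩ := z
    obtain rfl : w = 0 := hz2
    exact (hL.hasFDerivAt_zero hz).differentiableAt
  · exact (hL.contDiffAt ⟨hz, hz2⟩).differentiableAt (by simp)

theorem hasFDerivAt_momentum [FiniteDimensional ℝ V] (hL : IsFinslerLagrangian U L) {z : V × V}
    (hz : z.1 ∈ U) : HasFDerivAt (L z.1) (momentum L z) z.2 := by
  have h := hasFDerivAt_slice_right (hL.differentiableAt hz).hasFDerivAt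
  exact h.differentiableAt.hasFDerivAt

theorem hasFDerivAt_force [FiniteDimensional ℝ V] (hL : IsFinslerLagrangian U L) {z : V × V}
    (hz : z.1 ∈ U) : HasFDerivAt (fun u => L u z.2) (force L z) z.1 := by
  have h := hasFDerivAt_slice_left (hL.differentiableAt hz).hasFDerivAt
  exact h.differentiableAt.hasFDerivAt

theorem momentum_eq [FiniteDimensional ℝ V] (hL : IsFinslerLagrangian U L) {z : V × V}
    (hz : z.1 ∈ U) : momentum L z =
      fderiv ℝ (fun z : V × V => L z.1 z.2) z ∘L ContinuousLinearMap.inr ℝ V V :=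
  (hL.hasFDerivAt_momentum hz).unique
    (hasFDerivAt_slice_right (hL.differentiableAt hz).hasFDerivAt)

theorem force_eq [FiniteDimensional ℝ V] (hL : IsFinslerLagrangian U L) {z : V × V}
    (hz : z.1 ∈ U) : force L z =
      fderiv ℝ (fun z : V × V => L z.1 z.2) z ∘L ContinuousLinearMap.inl ℝ V V :=
  (hL.hasFDerivAt_force hz).unique
    (hasFDerivAt_slice_left (hL.differentiableAt hz).hasFDerivAt)

theorem hasFDerivAt_energy [FiniteDimensional ℝ V] (hL : IsFinslerLagrangian U L) {z : V × V}
    (hz : z.1 ∈ U) : HasFDerivAt (fun z : V × V => L z.1 z.2)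
      ((force L z).coprod (momentum L z)) z := by
  have h := (hL.differentiableAt hz).hasFDerivAt
  convert h using 1
  rw [hL.momentum_eq hz, hL.force_eq hz]
  ext <;> simp

theorem force_apply_zero [FiniteDimensional ℝ V] (hL : IsFinslerLagrangian U L) {u : V}
    (hu : u ∈ U) : force L (u, 0) = 0 := by
  rw [hL.force_eq (z := (u, 0)) hu, (hL.hasFDerivAt_zero hu).fderiv, ContinuousLinearMap.zero_comp]

theorem momentum_apply_zero [FiniteDimensional ℝ V] (hL : IsFinslerLagrangian U L) {u : V}
    (hu : u ∈ U) : momentum L (u, 0) = 0 := by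
  rw [hL.momentum_eq (z := (u, 0)) hu, (hL.hasFDerivAt_zero hu).fderiv,
    ContinuousLinearMap.zero_comp]

/-- The covector to which the inverse is applied vanishes at zero velocity, so the default value of
`ContinuousLinearMap.inverse` there does no harm. -/
theorem spray_apply_zero [FiniteDimensional ℝ V] (hL : IsFinslerLagrangian U L) {u : V}
    (hu : u ∈ U) : spray L (u, 0) = 0 := by
  have h0 : ((0 : V), (0 : V)) = 0 := rfl
  rw [spray, hL.force_apply_zero hu]
  simp [h0]

theorem contDiffOn_fderiv (hL : IsFinslerLagrangian U L) :
    ContDiffOn ℝ ∞ (fderiv ℝ fun z : V × V => L z.1 z.2) (U ×ˢ {0}ᶜ) :=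
  hL.smooth.fderiv_of_isOpen hL.isOpen_prod (by simp)

theorem contDiffOn_momentum [FiniteDimensional ℝ V] (hL : IsFinslerLagrangian U L) :
    ContDiffOn ℝ ∞ (momentum L) (U ×ˢ {0}ᶜ) :=
  (hL.contDiffOn_fderiv.clm_comp contDiffOn_const).congr fun _ hz => hL.momentum_eq hz.1

theorem contDiffOn_force [FiniteDimensional ℝ V] (hL : IsFinslerLagrangian U L) :
    ContDiffOn ℝ ∞ (force L) (U ×ˢ {0}ᶜ) :=
  (hL.contDiffOn_fderiv.clm_comp contDiffOn_const).congr fun _ hz => hL.force_eq hz.1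

theorem hasFDerivAt_fderiv_momentum [FiniteDimensional ℝ V] (hL : IsFinslerLagrangian U L)
    {z : V × V} (hz : z ∈ U ×ˢ ({0}ᶜ : Set V)) :
    HasFDerivAt (momentum L) (fderiv ℝ (momentum L) z) z :=
  ((hL.contDiffOn_momentum.contDiffAt (hL.isOpen_prod.mem_nhds hz)).differentiableAt
    (by simp)).hasFDerivAt

theorem fderiv_momentum_inr [FiniteDimensional ℝ V] (hL : IsFinslerLagrangian U L)
    {z : V × V} (hz : z ∈ U ×ˢ ({0}ᶜ : Set V)) :
    fderiv ℝ (momentum L) z ∘L ContinuousLinearMap.inr ℝ V V =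
      fderiv ℝ (fderiv ℝ (L z.1)) z.2 :=
  (hasFDerivAt_slice_right (hL.hasFDerivAt_fderiv_momentum hz)).fderiv.symm

/-- The fibre Hessian is positive definite, hence injective, and V and its dual have the same
dimension. -/
theorem exists_equiv_fderiv_momentum [FiniteDimensional ℝ V] (hL : IsFinslerLagrangian U L)
    {z : V × V} (hz : z ∈ U ×ˢ ({0}ᶜ : Set V)) :
    ∃ A : V ≃L[ℝ] (V →L[ℝ] ℝ), (A : V →L[ℝ] V →L[ℝ] ℝ) =
      fderiv ℝ (momentum L) z ∘L ContinuousLinearMap.inr ℝ V V := by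
  set B := fderiv ℝ (momentum L) z ∘L ContinuousLinearMap.inr ℝ V V with hB
  have hinj : Function.Injective (B : V →ₗ[ℝ] V →L[ℝ] ℝ) := by
    rw [← LinearMap.ker_eq_bot, LinearMap.ker_eq_bot']
    intro h hh
    by_contra hne
    have := hL.posDef z.1 hz.1 z.2 hz.2 h hne
    rw [← hL.fderiv_momentum_inr hz, ← hB] at this
    have h0 : B h = 0 := hh
    rw [h0] at this
    simp at this
  have hdim : Module.finrank ℝ V = Module.finrank ℝ (V →L[ℝ] ℝ) := by
    rw [(LinearMap.toContinuousLinearMap (𝕜 := ℝ) (E := V) (F' := ℝ)).symm.finrank_eq]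
    exact (Subspace.dual_finrank_eq (K := ℝ) (V := V)).symm
  refine ⟨(LinearMap.linearEquivOfInjective _ hinj hdim).toContinuousLinearEquiv, ?_⟩
  ext1 h
  rfl

theorem contDiffOn_spray [FiniteDimensional ℝ V] (hL : IsFinslerLagrangian U L) :
    ContDiffOn ℝ ∞ (spray L) (U ×ˢ {0}ᶜ) := by
  have : CompleteSpace V := FiniteDimensional.complete ℝ V
  intro z hz
  have hP : ContDiffAt ℝ ∞ (fderiv ℝ (momentum L)) z :=
    (hL.contDiffOn_momentum.contDiffAt (hL.isOpen_prod.mem_nhds hz)).fderiv_right (by simp)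
  have hq := hL.contDiffOn_force.contDiffAt (hL.isOpen_prod.mem_nhds hz)
  obtain ⟨A, hA⟩ := hL.exists_equiv_fderiv_momentum hz
  have hinv : ContDiffAt ℝ ∞ (fun z =>
      (fderiv ℝ (momentum L) z ∘L ContinuousLinearMap.inr ℝ V V).inverse) z := by
    refine ContDiffAt.comp z (g := ContinuousLinearMap.inverse) ?_ (hP.clm_comp contDiffAt_const)
    rw [← hA]
    exact contDiffAt_map_inverse A
  exact (hinv.clm_apply (hq.sub
    (hP.clm_apply (contDiffAt_snd.prodMk contDiffAt_const)))).contDiffWithinAt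

theorem eq_spray_iff [FiniteDimensional ℝ V] (hL : IsFinslerLagrangian U L)
    {z : V × V} (hz : z ∈ U ×ˢ ({0}ᶜ : Set V)) (k : V) :
    fderiv ℝ (momentum L) z (z.2, k) = force L z ↔ k = spray L z := by
  obtain ⟨A, hA⟩ := hL.exists_equiv_fderiv_momentum hz
  have h1 : fderiv ℝ (momentum L) z (z.2, k) = fderiv ℝ (momentum L) z (z.2, 0) + A k := by
    have : A k = (A : V →L[ℝ] V →L[ℝ] ℝ) k := rfl
    rw [this, hA, ContinuousLinearMap.comp_apply, ← map_add]
    simp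
  rw [h1, spray, ← hA, ContinuousLinearMap.inverse_equiv, ← eq_sub_iff_add_eq', eq_comm]
  constructor
  · intro h; rw [h]; simp
  · intro h; rw [h]; simp

theorem momentum_smul (hL : IsFinslerLagrangian U L) {u : V} (hu : u ∈ U) (w : V) {a : ℝ}
    (ha : 0 < a) : momentum L (u, a • w) = a • momentum L (u, w) := by
  have h1 : (fun w => L u (a • w)) = fun w => a ^ 2 * L u w := by
    ext w; exact hL.homogeneous u hu w a ha
  have h2 : fderiv ℝ (fun w => L u (a • w)) w = a • fderiv ℝ (L u) (a • w) :=
    fderiv_comp_smul a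
  rw [h1] at h2
  have h3 : fderiv ℝ (fun w => a ^ 2 * L u w) w = a ^ 2 • fderiv ℝ (L u) w :=
    congrFun (fderiv_const_smul_field (𝕜 := ℝ) (f := L u) (a ^ 2)) w
  rw [h3, pow_two, mul_smul] at h2
  exact (smul_right_injective _ ha.ne' h2).symm

theorem force_smul (hL : IsFinslerLagrangian U L) {u : V} (hu : u ∈ U) (w : V) {a : ℝ}
    (ha : 0 < a) : force L (u, a • w) = a ^ 2 • force L (u, w) := by
  have h1 : (fun u => L u (a • w)) =ᶠ[𝓝 u] fun u => a ^ 2 * L u w := by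
    filter_upwards [hL.isOpen.mem_nhds hu] with u hu using hL.homogeneous u hu w a ha
  have h3 : fderiv ℝ (fun u => a ^ 2 * L u w) u = a ^ 2 • fderiv ℝ (fun u => L u w) u :=
    congrFun (fderiv_const_smul_field (𝕜 := ℝ) (f := fun u => L u w) (a ^ 2)) u
  exact h1.fderiv_eq.trans h3

/-- Differentiating the degree one homogeneity of the momentum shows that a² times the old
acceleration solves the equation at (u, a • w), whose solution is unique. -/
theorem spray_smul [FiniteDimensional ℝ V] (hL : IsFinslerLagrangian U L) {u : V} (hu : u ∈ U)
    (w : V) {a : ℝ} (ha : 0 < a) : spray L (u, a • w) = a ^ 2 • spray L (u, w) := by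
  by_cases hw : w = 0
  · rw [hw, smul_zero, hL.spray_apply_zero hu, smul_zero]
  have hz : (u, w) ∈ U ×ˢ ({0}ᶜ : Set V) := ⟨hu, hw⟩
  have hz' : (u, a • w) ∈ U ×ˢ ({0}ᶜ : Set V) := ⟨hu, smul_ne_zero ha.ne' hw⟩
  symm
  rw [← hL.eq_spray_iff hz']
  have h1 := HasFDerivAt.comp (u, w) (f := fun z : V × V => (z.1, a • z.2))
    (hL.hasFDerivAt_fderiv_momentum hz') (hasFDerivAt_fiberScaling a (u, w))
  have h2 := (hL.hasFDerivAt_fderiv_momentum hz).const_smul a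
  have h3 : momentum L ∘ (fun z : V × V => (z.1, a • z.2)) =ᶠ[𝓝 (u, w)] a • momentum L := by
    filter_upwards [continuousAt_fst.preimage_mem_nhds (hL.isOpen.mem_nhds hu)] with y hy
    exact hL.momentum_smul hy y.2 ha
  have h4 := congrArg (fun A : V × V →L[ℝ] V →L[ℝ] ℝ => A (a • w, a • spray L (u, w)))
    (h1.unique (h2.congr_of_eventuallyEq h3))
  have h5 : (a • w, a • spray L (u, w)) = a • (w, spray L (u, w)) := rfl
  have h6 := (hL.eq_spray_iff hz _).2 rfl
  have h7 : fderiv ℝ (momentum L) (u, a • w) (a • w, a • a • spray L (u, w)) =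
      a • fderiv ℝ (momentum L) (u, w) (a • (w, spray L (u, w))) := h4
  rw [map_smul, h6, smul_smul, smul_smul, ← pow_two] at h7
  rw [h7, hL.force_smul hu w ha]

theorem momentum_self [FiniteDimensional ℝ V] (hL : IsFinslerLagrangian U L) {z : V × V}
    (hz : z.1 ∈ U) : momentum L z z.2 = 2 * L z.1 z.2 := by
  have h1 : HasDerivAt (fun a : ℝ => a • z.2) z.2 1 := by
    simpa using (hasDerivAt_id (1 : ℝ)).smul_const z.2
  have hm := hL.hasFDerivAt_momentum hz
  have h2 : HasDerivAt (fun a : ℝ => L z.1 (a • z.2)) (momentum L z z.2) 1 := by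
    rw [← one_smul ℝ z.2] at hm
    exact hm.comp_hasDerivAt 1 h1
  have h3 : HasDerivAt (fun a : ℝ => a ^ 2 * L z.1 z.2) (2 * L z.1 z.2) 1 := by
    simpa using (hasDerivAt_pow 2 (1 : ℝ)).mul_const (L z.1 z.2)
  refine h2.unique (h3.congr_of_eventuallyEq ?_)
  filter_upwards [lt_mem_nhds one_pos] with a ha
  exact hL.homogeneous z.1 hz z.2 a ha

/-- The momentum has degree one and, by Euler's identity p(w) = 2L > 0, does not vanish off the zero
section. The comparison with ‖w‖ handles instants of zero velocity, where the momentum need not be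
differentiable. -/
theorem exists_momentum_bounds [FiniteDimensional ℝ V] (hL : IsFinslerLagrangian U L) {u : V}
    (hu : u ∈ U) : ∃ m C : ℝ, 0 < m ∧ 0 < C ∧ ∀ᶠ u' in 𝓝 u, ∀ w,
      m * ‖w‖ ≤ ‖momentum L (u', w)‖ ∧ ‖momentum L (u', w)‖ ≤ C * ‖w‖ := by
  have : ProperSpace V := FiniteDimensional.proper ℝ V
  obtain ⟨R, hR, hRU⟩ := Metric.nhds_basis_closedBall.mem_iff.1 (hL.isOpen.mem_nhds hu)
  have hcont := hL.contDiffOn_momentum.continuousOn.mono (prod_mono_left hRU)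
  have hom : ∀ u' ∈ Metric.closedBall u R, ∀ w (a : ℝ), 0 < a →
      momentum L (u', a • w) = a ^ 1 • momentum L (u', w) := fun u' hu' w a ha => by
    rw [pow_one]; exact hL.momentum_smul (hRU hu') w ha
  obtain ⟨C, hC, hC'⟩ := exists_norm_le_of_homogeneous (isCompact_closedBall u R) hcont
    one_ne_zero hom
  obtain ⟨m, hm, hm'⟩ := exists_le_norm_of_homogeneous (isCompact_closedBall u R) hcont
    one_ne_zero hom fun u' hu' w hw h0 => by
      have h1 := hL.momentum_self (z := (u', w)) (hRU hu')
      have h2 := hL.pos u' (hRU hu') w hw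
      rw [h0] at h1
      simp at h1
      linarith
  refine ⟨m, C, hm, hC, ?_⟩
  filter_upwards [Metric.closedBall_mem_nhds u hR] with u' hu' w
  have h1 := hC' u' hu' w
  have h2 := hm' u' hu' w
  rw [pow_one] at h1 h2
  exact ⟨h2, h1⟩

/-- The Euler-Lagrange equation is equivalent to the second order equation of the spray. -/
theorem eulerLagrange_iff [FiniteDimensional ℝ V] (hL : IsFinslerLagrangian U L)
    {γ ν : ℝ → V} {A : V} {S : Set ℝ} {t : ℝ} (hS : UniqueDiffWithinAt ℝ S t)
    (hγU : γ t ∈ U) (hγ : HasDerivWithinAt γ (ν t) S t) (hν : HasDerivWithinAt ν A S t) :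
    HasDerivWithinAt (fun τ => momentum L (γ τ, ν τ)) (force L (γ t, ν t)) S t ↔
      A = spray L (γ t, ν t) := by
  -- At a zero of ν the force and the spray both vanish, and since ν and the momentum are
  -- comparable, one has derivative 0 exactly when the other does. Elsewhere the chain rule applies.
  by_cases h0 : ν t = 0
  · obtain ⟨m, C, hm, hC, hb⟩ := hL.exists_momentum_bounds hγU
    have hb' : ∀ᶠ τ in 𝓝[S] t, ∀ w,
      m * ‖w‖ ≤ ‖momentum L (γ τ, w)‖ ∧ ‖momentum L (γ τ, w)‖ ≤ C * ‖w‖ :=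
      hγ.continuousWithinAt.eventually hb
    have hp0 : momentum L (γ t, ν t) = 0 := by rw [h0]; exact hL.momentum_apply_zero hγU
    rw [show force L (γ t, ν t) = 0 by rw [h0]; exact hL.force_apply_zero hγU,
      show spray L (γ t, ν t) = 0 by rw [h0]; exact hL.spray_apply_zero hγU]
    have key : ∀ {X Y : Type _} [NormedAddCommGroup X] [NormedSpace ℝ X] [NormedAddCommGroup Y]
        [NormedSpace ℝ Y] (a : ℝ → X) (b : ℝ → Y) (c : ℝ), a t = 0 → b t = 0 →
        (∀ᶠ τ in 𝓝[S] t, ‖a τ‖ ≤ c * ‖b τ‖) → HasDerivWithinAt b 0 S t →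
        HasDerivWithinAt a 0 S t := by
      intro X Y _ _ _ _ a b c ha hb hab hd
      rw [hasDerivWithinAt_iff_isLittleO] at hd ⊢
      simp only [ha, hb, sub_zero, smul_zero] at hd ⊢
      exact (Asymptotics.IsBigO.of_bound c hab).trans_isLittleO hd
    constructor
    · intro h
      refine hS.eq_deriv _ hν (key ν (fun τ => momentum L (γ τ, ν τ)) m⁻¹ h0 hp0 ?_ h)
      filter_upwards [hb'] with τ hτ
      rw [inv_mul_eq_div, le_div_iff₀ hm, mul_comm]
      exact (hτ _).1
    · rintro rfl
      refine key (fun τ => momentum L (γ τ, ν τ)) ν C hp0 h0 ?_ hν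
      filter_upwards [hb'] with τ hτ using (hτ _).2
  · have hz : (γ t, ν t) ∈ U ×ˢ ({0}ᶜ : Set V) := ⟨hγU, h0⟩
    have h1 : HasDerivWithinAt (fun τ => momentum L (γ τ, ν τ))
        (fderiv ℝ (momentum L) (γ t, ν t) (ν t, A)) S t :=
      hasDerivWithinAt_along_curve (hL.hasFDerivAt_fderiv_momentum hz) hγ hν
    rw [← hL.eq_spray_iff hz]
    constructor
    · exact fun h => hS.eq_deriv _ h1 h
    · exact fun h => h ▸ h1

/-- By the Euler–Lagrange equation the derivative of p(ν) equals that of L, whereas p(ν) = 2L; hence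
both are zero. -/
theorem hasDerivWithinAt_energy [FiniteDimensional ℝ V] (hL : IsFinslerLagrangian U L)
    {γ ν : ℝ → V} {A : V} {S : Set ℝ} {t : ℝ} (hS : UniqueDiffWithinAt ℝ S t) (htS : t ∈ S)
    (hγU : γ t ∈ U) (hγ : HasDerivWithinAt γ (ν t) S t) (hν : HasDerivWithinAt ν A S t)
    (hEL : HasDerivWithinAt (fun τ => momentum L (γ τ, ν τ)) (force L (γ t, ν t)) S t) :
    HasDerivWithinAt (fun τ => L (γ τ) (ν τ)) 0 S t := by
  have h1 : HasDerivWithinAt (fun τ => L (γ τ) (ν τ))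
      (force L (γ t, ν t) (ν t) + momentum L (γ t, ν t) A) S t :=
    hasDerivWithinAt_along_curve (hL.hasFDerivAt_energy (z := (γ t, ν t)) hγU) hγ hν
  have h2 := hEL.clm_apply hν
  have h3 : HasDerivWithinAt (fun τ => 2 * L (γ τ) (ν τ))
      (force L (γ t, ν t) (ν t) + momentum L (γ t, ν t) A) S t := by
    refine h2.congr_of_eventuallyEq_of_mem ?_ htS
    filter_upwards [hγ.continuousWithinAt.eventually (hL.isOpen.mem_nhds hγU)] with τ hτ
    exact (hL.momentum_self (z := (γ τ, ν τ)) hτ).symm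
  have h4 := hS.eq_deriv _ h3 (h1.const_mul 2)
  have h5 : force L (γ t, ν t) (ν t) + momentum L (γ t, ν t) A = 0 := by linarith
  rwa [h5] at h1

end IsFinslerLagrangian

end Lagrangian

/-! ### Invariance of the Euler–Lagrange equation under change of coordinates -/

section Covariance

open scoped unitInterval

variable {V : Type*} [NormedAddCommGroup V] [NormedSpace ℝ V] [FiniteDimensional ℝ V]
  {U U' : Set V} {L L' : V → V → ℝ} {ψ : V → V}

/-- The solutions of the Euler-Lagrange equation do not depend on the coordinates. -/
theorem IsFinslerLagrangian.eulerLagrange_of_change (hL : IsFinslerLagrangian U L)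
    (hU' : IsOpen U') (hψ : ContDiffOn ℝ ∞ ψ U') (hmaps : MapsTo ψ U' U)
    (hL' : ∀ u ∈ U', ∀ w, L' u w = L (ψ u) (fderiv ℝ ψ u w))
    {γ ν : ℝ → V} {S : Set ℝ} {t : ℝ} (htS : t ∈ S) (hγU : γ t ∈ U')
    (hγ : HasDerivWithinAt γ (ν t) S t)
    (hEL : HasDerivWithinAt (fun τ => momentum L (ψ (γ τ), fderiv ℝ ψ (γ τ) (ν τ)))
      (force L (ψ (γ t), fderiv ℝ ψ (γ t) (ν t))) S t) :
    HasDerivWithinAt (fun τ => momentum L' (γ τ, ν τ)) (force L' (γ t, ν t)) S t := by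
  have hψat : ∀ u ∈ U', ContDiffAt ℝ ∞ ψ u := fun u hu => hψ.contDiffAt (hU'.mem_nhds hu)
  have hdψ : ∀ u ∈ U', HasFDerivAt (fderiv ℝ ψ) (fderiv ℝ (fderiv ℝ ψ) u) u := fun u hu =>
    (((hψat u hu).fderiv_right (m := ∞) (by simp)).differentiableAt (by simp)).hasFDerivAt
  have hmom : ∀ u ∈ U', ∀ w, momentum L' (u, w) =
      (momentum L (ψ u, fderiv ℝ ψ u w)).comp (fderiv ℝ ψ u) := by
    intro u hu w
    have h1 : L' u = fun w => L (ψ u) (fderiv ℝ ψ u w) := funext (hL' u hu)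
    have h2 := hL.hasFDerivAt_momentum (z := (ψ u, fderiv ℝ ψ u w)) (hmaps hu)
    have h3 := HasFDerivAt.comp w (f := fun w => fderiv ℝ ψ u w) h2 (fderiv ℝ ψ u).hasFDerivAt
    rw [momentum]
    simp only
    rw [h1]
    exact h3.fderiv
  have hforce : ∀ u ∈ U', ∀ w, force L' (u, w) =
      (force L (ψ u, fderiv ℝ ψ u w)).comp (fderiv ℝ ψ u) +
        (momentum L (ψ u, fderiv ℝ ψ u w)).comp ((fderiv ℝ (fderiv ℝ ψ) u).flip w) := by
    intro u hu w
    have h1 : (fun u => L' u w) =ᶠ[𝓝 u] fun u => L (ψ u) (fderiv ℝ ψ u w) := by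
      filter_upwards [hU'.mem_nhds hu] with u hu using hL' u hu w
    have h2 := hL.hasFDerivAt_energy (z := (ψ u, fderiv ℝ ψ u w)) (hmaps hu)
    have h3 : HasFDerivAt (fun u => (ψ u, fderiv ℝ ψ u w))
        ((fderiv ℝ ψ u).prod ((fderiv ℝ (fderiv ℝ ψ) u).flip w)) u := by
      refine HasFDerivAt.prodMk ((hψat u hu).differentiableAt (by simp)).hasFDerivAt ?_
      have := (hdψ u hu).clm_apply (hasFDerivAt_const w u)
      simpa using this
    have h4 := HasFDerivAt.comp u (f := fun u => (ψ u, fderiv ℝ ψ u w)) h2 h3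
    rw [force]
    simp only
    rw [h1.fderiv_eq]
    refine h4.fderiv.trans ?_
    ext h
    simp
  have hnear : ∀ᶠ τ in 𝓝[S] t, γ τ ∈ U' :=
    hγ.continuousWithinAt.eventually (hU'.mem_nhds hγU)
  have hd : HasDerivWithinAt (fun τ => fderiv ℝ ψ (γ τ))
      (fderiv ℝ (fderiv ℝ ψ) (γ t) (ν t)) S t :=
    (hdψ _ hγU).comp_hasDerivWithinAt t hγ
  have hcomp := hEL.clm_comp hd
  rw [hforce _ hγU]
  refine (hcomp.congr_of_eventuallyEq_of_mem ?_ htS).congr_deriv ?_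
  · filter_upwards [hnear] with τ hτ using hmom _ hτ _
  · congr 2
    -- One term differentiates ψ' along the velocity, the other comes from the position derivative
    -- of ψ'(u)w; they agree because ψ'' is symmetric.
    ext h
    have hs := (hψat _ hγU).isSymmSndFDerivAt (by
      rw [minSmoothness_of_isRCLikeNormedField]; exact WithTop.coe_le_coe.2 le_top)
    exact hs.eq _ _

end Covariance

/-! ### Finsler metrics in chart coordinates -/

section ChartCoordinates

variable {n : ℕ} {M : Type*} [TopologicalSpace M] [ChartedSpace (EuclideanSpace ℝ (Fin n)) M]

/-- The tangent vector at `x` given by a coordinate vector in the preferred chart at `x`. -/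
def tangentVector (x : M) (v : EuclideanSpace ℝ (Fin n)) : TangentBundle (𝓡 n) M := ⟨x, v⟩

/-- The derivative of the inverse of the chart `e`, as a map between coordinate spaces. -/
noncomputable def symmDeriv (e : OpenPartialHomeomorph M (EuclideanSpace ℝ (Fin n)))
    (u : EuclideanSpace ℝ (Fin n)) : EuclideanSpace ℝ (Fin n) →L[ℝ] EuclideanSpace ℝ (Fin n) :=
  mfderiv (𝓡 n) (𝓡 n) e.symm u

/-- The tangent vector with coordinates `z = (u, w)` in the chart `e`. -/
noncomputable def chartVector (e : OpenPartialHomeomorph M (EuclideanSpace ℝ (Fin n)))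
    (z : EuclideanSpace ℝ (Fin n) × EuclideanSpace ℝ (Fin n)) : TangentBundle (𝓡 n) M :=
  tangentVector (e.symm z.1) (symmDeriv e z.1 z.2)

theorem localEnergy_eq (F : TangentBundle (𝓡 n) M → ℝ)
    (e : OpenPartialHomeomorph M (EuclideanSpace ℝ (Fin n))) (u w : EuclideanSpace ℝ (Fin n)) :
    localEnergy F e u w = 1 / 2 * F (chartVector e (u, w)) ^ 2 := rfl

theorem fundamentalTensor_eq (F : TangentBundle (𝓡 n) M → ℝ) (x : M)
    (v w u : EuclideanSpace ℝ (Fin n)) :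
    fundamentalTensor F x v w u = (1 / 2) * deriv (fun s : ℝ => deriv (fun t : ℝ =>
      F (tangentVector x (v + s • w + t • u)) ^ 2) 0) 0 := rfl

variable [IsManifold (𝓡 n) ∞ M] {e : OpenPartialHomeomorph M (EuclideanSpace ℝ (Fin n))}
  {F : TangentBundle (𝓡 n) M → ℝ}

theorem mdifferentiable_of_mem_atlas (he : e ∈ atlas (EuclideanSpace ℝ (Fin n)) M) :
    e.MDifferentiable (𝓡 n) (𝓡 n) := by
  have : IsManifold (𝓡 n) 1 M := IsManifold.of_le (n := ∞) (by simp)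
  exact _root_.mdifferentiable_of_mem_atlas he

theorem contMDiff_modelVector (n : ℕ) :
    ContMDiff 𝓘(ℝ, EuclideanSpace ℝ (Fin n) × EuclideanSpace ℝ (Fin n)) (𝓡 n).tangent ∞
      (fun z : EuclideanSpace ℝ (Fin n) × EuclideanSpace ℝ (Fin n) =>
        (⟨z.1, z.2⟩ : TangentBundle (𝓡 n) (EuclideanSpace ℝ (Fin n)))) := by
  have h := contMDiff_tangentBundleModelSpaceHomeomorph_symm (I := 𝓡 n) (n := ∞)
  rw [modelWithCornersSelf_prod]
  convert! h

theorem contMDiffOn_chartVector (he : e ∈ atlas (EuclideanSpace ℝ (Fin n)) M) :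
    ContMDiffOn 𝓘(ℝ, EuclideanSpace ℝ (Fin n) × EuclideanSpace ℝ (Fin n)) (𝓡 n).tangent ∞
      (chartVector e) (e.target ×ˢ univ) := by
  have : IsManifold (𝓡 n) 1 M := IsManifold.of_le (n := ∞) (by simp)
  have h1 : ContMDiffOn (𝓡 n) (𝓡 n) ∞ e.symm e.target :=
    contMDiffOn_symm_of_mem_maximalAtlas (IsManifold.subset_maximalAtlas he)
  have h2 := h1.contMDiffOn_tangentMapWithin (m := ∞) (by simp)
    e.open_target.uniqueMDiffOn
  refine (h2.comp (contMDiff_modelVector n).contMDiffOn (fun z hz => hz.1)).congr fun z hz => ?_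
  change _ = tangentMapWithin (𝓡 n) (𝓡 n) e.symm e.target ⟨z.1, z.2⟩
  rw [tangentMapWithin, mfderivWithin_of_mem_nhds (e.open_target.mem_nhds hz.1)]
  rfl

theorem symmDeriv_injective (he : e ∈ atlas (EuclideanSpace ℝ (Fin n)) M)
    {u : EuclideanSpace ℝ (Fin n)} (hu : u ∈ e.target) : Function.Injective (symmDeriv e u) :=
  (mdifferentiable_of_mem_atlas he).symm.mfderiv_injective hu

theorem symmDeriv_ne_zero (he : e ∈ atlas (EuclideanSpace ℝ (Fin n)) M)
    {u w : EuclideanSpace ℝ (Fin n)} (hu : u ∈ e.target) (hw : w ≠ 0) : symmDeriv e u w ≠ 0 :=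
  (map_ne_zero_iff _ (symmDeriv_injective he hu)).2 hw

namespace IsFinslerMetric

theorem apply_zero (hF : IsFinslerMetric F) (x : M) : F (tangentVector x 0) = 0 := by
  have h : F (tangentVector x ((2 : ℝ) • 0)) = 2 * F (tangentVector x 0) :=
    hF.homogeneous x 0 2 two_pos
  rw [smul_zero] at h
  linarith

theorem nonneg (hF : IsFinslerMetric F) (X : TangentBundle (𝓡 n) M) : 0 ≤ F X := by
  obtain ⟨x, v⟩ := X
  by_cases hv : v = 0
  · rw [hv]
    exact (hF.apply_zero x).ge
  · exact (hF.pos x v hv).le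

theorem chartMetric_smul (hF : IsFinslerMetric F) (u w : EuclideanSpace ℝ (Fin n)) {a : ℝ}
    (ha : 0 < a) : F (chartVector e (u, a • w)) = a * F (chartVector e (u, w)) := by
  simp only [chartVector]
  rw [map_smul]
  exact hF.homogeneous _ _ _ ha

theorem chartMetric_pos (hF : IsFinslerMetric F) (he : e ∈ atlas (EuclideanSpace ℝ (Fin n)) M)
    {u w : EuclideanSpace ℝ (Fin n)} (hu : u ∈ e.target) (hw : w ≠ 0) :
    0 < F (chartVector e (u, w)) :=
  hF.pos _ _ (symmDeriv_ne_zero he hu hw)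

theorem continuousOn_chartMetric (hF : IsFinslerMetric F)
    (he : e ∈ atlas (EuclideanSpace ℝ (Fin n)) M) :
    ContinuousOn (fun z => F (chartVector e z)) (e.target ×ˢ univ) :=
  hF.continuous.comp_continuousOn (contMDiffOn_chartVector he).continuousOn

theorem contDiffOn_chartMetric (hF : IsFinslerMetric F)
    (he : e ∈ atlas (EuclideanSpace ℝ (Fin n)) M) :
    ContDiffOn ℝ ∞ (fun z => F (chartVector e z)) (e.target ×ˢ {0}ᶜ) := by
  rw [← contMDiffOn_iff_contDiffOn]
  exact hF.smooth.comp ((contMDiffOn_chartVector he).mono (prod_mono_right (subset_univ _)))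
    fun z hz => symmDeriv_ne_zero he hz.1 hz.2

/-- The chart acts on fibres by an injective linear map, so the fundamental tensor pulls back to the
fibre Hessian of the local energy; the work is to turn its iterated one-variable derivatives into
`fderiv`. -/
theorem isFinslerLagrangian_localEnergy (hF : IsFinslerMetric F)
    (he : e ∈ atlas (EuclideanSpace ℝ (Fin n)) M) :
    IsFinslerLagrangian e.target (localEnergy F e) := by
  have hsmooth : ContDiffOn ℝ ∞ (fun z : EuclideanSpace ℝ (Fin n) × EuclideanSpace ℝ (Fin n) =>
      localEnergy F e z.1 z.2) (e.target ×ˢ {0}ᶜ) :=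
    contDiffOn_const.mul ((hF.contDiffOn_chartMetric he).pow 2)
  refine ⟨e.open_target, hsmooth, ?_, ?_, ?_⟩
  · intro u _ w a ha
    rw [localEnergy_eq, hF.chartMetric_smul u w ha, localEnergy_eq]
    ring
  · intro u hu w hw
    rw [localEnergy_eq]
    have := hF.chartMetric_pos he hu hw
    positivity
  · intro u hu w hw h hh
    have hat : ∀ w', w' ≠ 0 → ContDiffAt ℝ ∞ (localEnergy F e u) w' := fun w' hw' =>
      (hsmooth.contDiffAt ((e.open_target.prod isOpen_compl_singleton).mem_nhds
        (show (u, w') ∈ e.target ×ˢ ({0}ᶜ : Set _) from ⟨hu, hw'⟩))).comp w'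
        (f := fun w' => (u, w')) (contDiffAt_const.prodMk contDiffAt_id)
    have hpos : 0 < fundamentalTensor F (e.symm u) (symmDeriv e u w)
        (symmDeriv e u h) (symmDeriv e u h) :=
      hF.posDef _ _ _ (symmDeriv_ne_zero he hu hw) (symmDeriv_ne_zero he hu hh)
    rw [fundamentalTensor_eq] at hpos
    have hline : ∀ w' : EuclideanSpace ℝ (Fin n),
        HasDerivAt (fun s : ℝ => w' + s • h) h 0 := fun w' => by
      simpa using ((hasDerivAt_id (0 : ℝ)).smul_const h).const_add w'
    have hinner : ∀ w' : EuclideanSpace ℝ (Fin n), w' ≠ 0 → deriv (fun t : ℝ =>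
        F (tangentVector (e.symm u) (symmDeriv e u w' + t • symmDeriv e u h)) ^ 2) 0
        = 2 * fderiv ℝ (localEnergy F e u) w' h := by
      intro w' hw'
      have h1 : (fun t : ℝ =>
          F (tangentVector (e.symm u) (symmDeriv e u w' + t • symmDeriv e u h)) ^ 2) =
          fun t => 2 * localEnergy F e u (w' + t • h) := by
        ext t
        rw [localEnergy_eq, chartVector, map_add, map_smul]
        ring
      rw [h1]
      have h2 : HasFDerivAt (localEnergy F e u) (fderiv ℝ (localEnergy F e u) w')
          (w' + (0 : ℝ) • h) := by
        rw [zero_smul, add_zero]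
        exact ((hat w' hw').differentiableAt (by simp)).hasFDerivAt
      exact ((h2.comp_hasDerivAt 0 (hline w')).const_mul 2).deriv
    have houter : (fun s : ℝ => deriv (fun t : ℝ => F (tangentVector (e.symm u)
        (symmDeriv e u w + s • symmDeriv e u h + t • symmDeriv e u h)) ^ 2) 0) =ᶠ[𝓝 0]
        fun s => 2 * fderiv ℝ (localEnergy F e u) (w + s • h) h := by
      have hne : ∀ᶠ s : ℝ in 𝓝 0, w + s • h ≠ 0 :=
        (hline w).continuousAt.eventually_ne (by simpa using hw)
      filter_upwards [hne] with s hs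
      rw [← hinner _ hs, map_add, map_smul]
    have h3 : HasFDerivAt (fderiv ℝ (localEnergy F e u))
        (fderiv ℝ (fderiv ℝ (localEnergy F e u)) w) (w + (0 : ℝ) • h) := by
      rw [zero_smul, add_zero]
      exact (((hat w hw).fderiv_right (m := ∞) (by simp)).differentiableAt (by simp)).hasFDerivAt
    have h4 : HasDerivAt (fun s : ℝ => fderiv ℝ (localEnergy F e u) (w + s • h))
        (fderiv ℝ (fderiv ℝ (localEnergy F e u)) w h) 0 := h3.comp_hasDerivAt 0 (hline w)
    have h5 : HasDerivAt (fun s : ℝ => 2 * fderiv ℝ (localEnergy F e u) (w + s • h) h)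
        (2 * fderiv ℝ (fderiv ℝ (localEnergy F e u)) w h h) 0 := by
      simpa using (h4.clm_apply (hasDerivAt_const (0 : ℝ) h)).const_mul 2
    rw [houter.deriv_eq, h5.deriv] at hpos
    linarith

end IsFinslerMetric

end ChartCoordinates

/-! ### Geodesics in charts, constant speed and length -/

section ChartCurves

variable {n : ℕ} {M : Type*} [TopologicalSpace M] [ChartedSpace (EuclideanSpace ℝ (Fin n)) M]

/-- The derivative of the chart `e`, as a map between coordinate spaces. -/
noncomputable def chartDeriv (e : OpenPartialHomeomorph M (EuclideanSpace ℝ (Fin n)))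
    (x : M) : EuclideanSpace ℝ (Fin n) →L[ℝ] EuclideanSpace ℝ (Fin n) :=
  mfderiv (𝓡 n) (𝓡 n) e x

/-- The coordinates of a tangent vector in the chart `e`. -/
noncomputable def chartCoord (e : OpenPartialHomeomorph M (EuclideanSpace ℝ (Fin n)))
    (X : TangentBundle (𝓡 n) M) : EuclideanSpace ℝ (Fin n) × EuclideanSpace ℝ (Fin n) :=
  (e X.1, chartDeriv e X.1 X.2)

variable [IsManifold (𝓡 n) ∞ M] {e e' : OpenPartialHomeomorph M (EuclideanSpace ℝ (Fin n))}
  {F : TangentBundle (𝓡 n) M → ℝ}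

theorem symmDeriv_chartDeriv (he : e ∈ atlas (EuclideanSpace ℝ (Fin n)) M) {x : M}
    (hx : x ∈ e.source) (v : EuclideanSpace ℝ (Fin n)) :
    symmDeriv e (e x) (chartDeriv e x v) = v :=
  congrArg (fun A : EuclideanSpace ℝ (Fin n) →L[ℝ] EuclideanSpace ℝ (Fin n) => A v)
    ((mdifferentiable_of_mem_atlas he).symm_comp_deriv hx)

theorem chartDeriv_symmDeriv (he : e ∈ atlas (EuclideanSpace ℝ (Fin n)) M)
    {u : EuclideanSpace ℝ (Fin n)} (hu : u ∈ e.target) (w : EuclideanSpace ℝ (Fin n)) :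
    chartDeriv e (e.symm u) (symmDeriv e u w) = w :=
  congrArg (fun A : EuclideanSpace ℝ (Fin n) →L[ℝ] EuclideanSpace ℝ (Fin n) => A w)
    ((mdifferentiable_of_mem_atlas he).comp_symm_deriv hu)

theorem chartVector_chartDeriv (he : e ∈ atlas (EuclideanSpace ℝ (Fin n)) M) {x : M}
    (hx : x ∈ e.source) (v : EuclideanSpace ℝ (Fin n)) :
    chartVector e (e x, chartDeriv e x v) = tangentVector x v := by
  rw [chartVector, symmDeriv_chartDeriv he hx, e.left_inv hx]

theorem chartVector_chartCoord (he : e ∈ atlas (EuclideanSpace ℝ (Fin n)) M)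
    {X : TangentBundle (𝓡 n) M} (hX : X.1 ∈ e.source) : chartVector e (chartCoord e X) = X :=
  chartVector_chartDeriv he hX X.2

/-- The derivative of the chart `e` at `x`, as an equivalence between coordinate spaces. -/
noncomputable def chartDerivEquiv (he : e ∈ atlas (EuclideanSpace ℝ (Fin n)) M) {x : M}
    (hx : x ∈ e.source) : EuclideanSpace ℝ (Fin n) ≃L[ℝ] EuclideanSpace ℝ (Fin n) :=
  ContinuousLinearEquiv.equivOfInverse (chartDeriv e x) (symmDeriv e (e x))
    (symmDeriv_chartDeriv he hx) (fun w => by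
      have := chartDeriv_symmDeriv he (e.map_source hx) w
      rwa [e.left_inv hx] at this)

theorem hasFDerivAt_chart_change (he : e ∈ atlas (EuclideanSpace ℝ (Fin n)) M)
    (he' : e' ∈ atlas (EuclideanSpace ℝ (Fin n)) M) {u : EuclideanSpace ℝ (Fin n)}
    (hu : u ∈ e'.target) (hu' : e'.symm u ∈ e.source) :
    HasFDerivAt (e ∘ e'.symm) ((chartDeriv e (e'.symm u)).comp (symmDeriv e' u)) u := by
  have h := HasMFDerivAt.comp u
    ((mdifferentiable_of_mem_atlas he).mdifferentiableAt hu').hasMFDerivAt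
    ((mdifferentiable_of_mem_atlas he').mdifferentiableAt_symm hu).hasMFDerivAt
  exact h.hasFDerivAt

theorem chartVector_chart_change (he : e ∈ atlas (EuclideanSpace ℝ (Fin n)) M)
    (he' : e' ∈ atlas (EuclideanSpace ℝ (Fin n)) M) {u : EuclideanSpace ℝ (Fin n)}
    (hu : u ∈ e'.target) (hu' : e'.symm u ∈ e.source) (w : EuclideanSpace ℝ (Fin n)) :
    chartVector e' (u, w) =
      chartVector e ((e ∘ e'.symm) u, fderiv ℝ (e ∘ e'.symm) u w) := by
  rw [(hasFDerivAt_chart_change he he' hu hu').fderiv, chartVector, chartVector]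
  simp only [ContinuousLinearMap.comp_apply, Function.comp_apply]
  rw [symmDeriv_chartDeriv he hu', e.left_inv hu']

theorem contDiffOn_chart_change (he : e ∈ atlas (EuclideanSpace ℝ (Fin n)) M)
    (he' : e' ∈ atlas (EuclideanSpace ℝ (Fin n)) M) :
    ContDiffOn ℝ ∞ (e ∘ e'.symm) (e'.symm.trans e).source := by
  rw [← contMDiffOn_iff_contDiffOn]
  have h1 : ContMDiffOn (𝓡 n) (𝓡 n) ∞ e e.source :=
    contMDiffOn_of_mem_maximalAtlas (IsManifold.subset_maximalAtlas he)
  have h2 : ContMDiffOn (𝓡 n) (𝓡 n) ∞ e'.symm e'.target :=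
    contMDiffOn_symm_of_mem_maximalAtlas (IsManifold.subset_maximalAtlas he')
  refine h1.comp (h2.mono ?_) ?_
  · intro u hu
    rw [OpenPartialHomeomorph.trans_source] at hu
    exact hu.1
  · intro u hu
    rw [OpenPartialHomeomorph.trans_source] at hu
    exact hu.2

theorem contDiffWithinAt_chart_comp (he : e ∈ atlas (EuclideanSpace ℝ (Fin n)) M) {c : ℝ → M}
    {S : Set ℝ} {t : ℝ} (hc : ContMDiffWithinAt 𝓘(ℝ, ℝ) (𝓡 n) 2 c S t) (ht : c t ∈ e.source) :
    ContDiffWithinAt ℝ 2 (fun τ => e (c τ)) S t := by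
  have h1 : ContMDiffOn (𝓡 n) (𝓡 n) ∞ e e.source :=
    contMDiffOn_of_mem_maximalAtlas (IsManifold.subset_maximalAtlas he)
  have h2 := (h1.contMDiffAt (e.open_source.mem_nhds ht)).of_le
    (show (2 : ℕ∞ω) ≤ ∞ from WithTop.coe_le_coe.2 le_top)
  rw [← contMDiffWithinAt_iff_contDiffWithinAt]
  exact ContMDiffAt.comp_contMDiffWithinAt t h2 hc

theorem uniqueDiffOn_unitInterval : UniqueDiffOn ℝ (Icc (0 : ℝ) 1) := uniqueDiffOn_Icc one_pos

theorem chartCoord_velocity (he : e ∈ atlas (EuclideanSpace ℝ (Fin n)) M) {c : ℝ → M} {t : ℝ}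
    (hc : ContMDiffWithinAt 𝓘(ℝ, ℝ) (𝓡 n) 2 c (Icc 0 1) t) (htI : t ∈ Icc (0 : ℝ) 1)
    (ht : c t ∈ e.source) :
    chartCoord e (velocity c t) =
      (e (c t), derivWithin (fun r => e (c r)) (Icc 0 1) t) := by
  have h1 : HasMFDerivWithinAt 𝓘(ℝ, ℝ) (𝓡 n) (fun r => e (c r)) (Icc 0 1) t
      ((mfderiv (𝓡 n) (𝓡 n) e (c t)).comp (mfderivWithin 𝓘(ℝ, ℝ) (𝓡 n) c (Icc 0 1) t)) :=
    HasMFDerivAt.comp_hasMFDerivWithinAt t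
      ((mdifferentiable_of_mem_atlas he).mdifferentiableAt ht).hasMFDerivAt
      (hc.mdifferentiableWithinAt (by simp)).hasMFDerivWithinAt
  let A : ℝ →L[ℝ] EuclideanSpace ℝ (Fin n) := mfderivWithin 𝓘(ℝ, ℝ) (𝓡 n) c (Icc 0 1) t
  have h2 : HasFDerivWithinAt (fun r => e (c r)) ((chartDeriv e (c t)).comp A) (Icc 0 1) t :=
    h1.hasFDerivWithinAt
  exact Prod.ext rfl (h2.hasDerivWithinAt.derivWithin (uniqueDiffOn_unitInterval t htI)).symm

theorem velocity_eq_chartVector (he : e ∈ atlas (EuclideanSpace ℝ (Fin n)) M) {c : ℝ → M} {t : ℝ}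
    (hc : ContMDiffWithinAt 𝓘(ℝ, ℝ) (𝓡 n) 2 c (Icc 0 1) t) (htI : t ∈ Icc (0 : ℝ) 1)
    (ht : c t ∈ e.source) :
    velocity c t = chartVector e (e (c t), derivWithin (fun r => e (c r)) (Icc 0 1) t) := by
  rw [← chartCoord_velocity he hc htI ht]
  exact (chartVector_chartCoord he ht).symm

theorem hasDerivWithinAt_derivWithin {V : Type*} [NormedAddCommGroup V] [NormedSpace ℝ V]
    {γ : ℝ → V} {t : ℝ} (htI : t ∈ Icc (0 : ℝ) 1) (hγ : ContDiffWithinAt ℝ 2 γ (Icc 0 1) t) :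
    HasDerivWithinAt γ (derivWithin γ (Icc 0 1) t) (Icc 0 1) t ∧
      HasDerivWithinAt (derivWithin γ (Icc 0 1))
        (derivWithin (derivWithin γ (Icc 0 1)) (Icc 0 1) t) (Icc 0 1) t :=
  ⟨(hγ.differentiableWithinAt (by simp)).hasDerivWithinAt,
    ((hγ.derivWithin (m := 1) uniqueDiffOn_unitInterval (by norm_num)
      htI).differentiableWithinAt (by simp)).hasDerivWithinAt⟩

/-- In a chart, a geodesic solves the second order equation of the spray. -/
theorem IsGeodesic.hasDerivWithinAt (hF : IsFinslerMetric F) {c : ℝ → M} (hc : IsGeodesic F c)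
    (he : e ∈ atlas (EuclideanSpace ℝ (Fin n)) M) {t : ℝ} (htI : t ∈ Icc (0 : ℝ) 1)
    (ht : c t ∈ e.source) :
    HasDerivWithinAt (fun r => e (c r)) (derivWithin (fun r => e (c r)) (Icc 0 1) t)
      (Icc 0 1) t ∧
    HasDerivWithinAt (derivWithin (fun r => e (c r)) (Icc 0 1))
      (spray (localEnergy F e) (e (c t), derivWithin (fun r => e (c r)) (Icc 0 1) t))
      (Icc 0 1) t := by
  obtain ⟨h1, h2⟩ := hasDerivWithinAt_derivWithin htI
    (contDiffWithinAt_chart_comp he (hc.contMDiffOn t htI) ht)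
  have h3 := ((hF.isFinslerLagrangian_localEnergy he).eulerLagrange_iff
    (uniqueDiffOn_unitInterval t htI) (e.map_source ht) h1 h2).1 (hc.eulerLagrange e he t htI ht)
  exact ⟨h1, h3 ▸ h2⟩

/-- A solution of the second order equation of the spray in a chart is a geodesic. -/
theorem isGeodesic_of_hasDerivWithinAt (hF : IsFinslerMetric F)
    (he : e ∈ atlas (EuclideanSpace ℝ (Fin n)) M) {γ ν : ℝ → EuclideanSpace ℝ (Fin n)}
    (hcont : ContDiffOn ℝ 2 γ (Icc 0 1)) (hmem : ∀ t ∈ Icc (0 : ℝ) 1, γ t ∈ e.target)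
    (hγ : ∀ t ∈ Icc (0 : ℝ) 1, HasDerivWithinAt γ (ν t) (Icc 0 1) t)
    (hν : ∀ t ∈ Icc (0 : ℝ) 1,
      HasDerivWithinAt ν (spray (localEnergy F e) (γ t, ν t)) (Icc 0 1) t) :
    IsGeodesic F (fun t => e.symm (γ t)) := by
  have hL := hF.isFinslerLagrangian_localEnergy he
  have hC2 : ContMDiffOn 𝓘(ℝ, ℝ) (𝓡 n) 2 (fun t => e.symm (γ t)) (Icc 0 1) := by
    have h2 : ContMDiffOn (𝓡 n) (𝓡 n) ∞ e.symm e.target :=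
      contMDiffOn_symm_of_mem_maximalAtlas (IsManifold.subset_maximalAtlas he)
    exact (h2.of_le (show (2 : ℕ∞ω) ≤ ∞ from WithTop.coe_le_coe.2 le_top)).comp
      hcont.contMDiffOn hmem
  -- The definition asks for the equation in every chart e' of the atlas; it is transported from e
  -- by the transition map `e ∘ e'.symm`, and only near t, since the curve may leave the source of
  -- e'.
  refine ⟨hC2, fun e' he' t htI ht => ?_⟩
  let c : ℝ → M := fun t => e.symm (γ t)
  let γ' : ℝ → EuclideanSpace ℝ (Fin n) := fun r => e' (c r)
  have hback : ∀ τ ∈ Icc (0 : ℝ) 1, c τ ∈ e'.source → (e ∘ e'.symm) (γ' τ) = γ τ := by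
    intro τ hτ hτ'
    simp only [Function.comp_apply, γ']
    rw [e'.left_inv hτ']
    exact e.right_inv (hmem τ hτ)
  have hsrc : ∀ τ ∈ Icc (0 : ℝ) 1, c τ ∈ e'.source → γ' τ ∈ (e'.symm.trans e).source := by
    intro τ hτ hτ'
    rw [OpenPartialHomeomorph.trans_source]
    refine ⟨e'.map_source hτ', ?_⟩
    simp only [γ', mem_preimage]
    rw [e'.left_inv hτ']
    exact e.map_target (hmem τ hτ)
  have hγ' : ∀ τ ∈ Icc (0 : ℝ) 1, c τ ∈ e'.source →
      HasDerivWithinAt γ' (derivWithin γ' (Icc 0 1) τ) (Icc 0 1) τ := fun τ hτ hτ' =>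
    ((contDiffWithinAt_chart_comp he' (hC2 τ hτ) hτ').differentiableWithinAt
      (by simp)).hasDerivWithinAt
  have hnear : ∀ τ ∈ Icc (0 : ℝ) 1, c τ ∈ e'.source →
      ∀ᶠ σ in 𝓝[Icc 0 1] τ, σ ∈ Icc (0 : ℝ) 1 ∧ c σ ∈ e'.source := fun τ hτ hτ' =>
    Filter.Eventually.and self_mem_nhdsWithin
      ((hC2 τ hτ).continuousWithinAt.eventually (e'.open_source.mem_nhds hτ'))
  have hψ := contDiffOn_chart_change he he'
  have hvel : ∀ τ ∈ Icc (0 : ℝ) 1, c τ ∈ e'.source →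
      fderiv ℝ (e ∘ e'.symm) (γ' τ) (derivWithin γ' (Icc 0 1) τ) = ν τ := by
    intro τ hτ hτ'
    have h1 : HasFDerivAt (e ∘ e'.symm) (fderiv ℝ (e ∘ e'.symm) (γ' τ)) (γ' τ) :=
      ((hψ.contDiffAt ((e'.symm.trans e).open_source.mem_nhds
        (hsrc τ hτ hτ'))).differentiableAt (by simp)).hasFDerivAt
    refine (uniqueDiffOn_unitInterval τ hτ).eq_deriv _ ?_ (hγ τ hτ)
    refine (h1.comp_hasDerivWithinAt τ (hγ' τ hτ hτ')).congr_of_eventuallyEq_of_mem ?_ hτ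
    filter_upwards [hnear τ hτ hτ'] with σ hσ using (hback σ hσ.1 hσ.2).symm
  refine hL.eulerLagrange_of_change (L' := localEnergy F e') (γ := γ')
    (ν := derivWithin γ' (Icc 0 1)) (e'.symm.trans e).open_source hψ ?_ ?_ htI
    (hsrc t htI ht) (hγ' t htI ht) ?_
  · intro u hu
    rw [OpenPartialHomeomorph.trans_source] at hu
    exact e.map_source hu.2
  · intro u hu w
    rw [OpenPartialHomeomorph.trans_source] at hu
    rw [localEnergy_eq, localEnergy_eq, chartVector_chart_change he he' hu.1 hu.2]
  · rw [hvel t htI ht, hback t htI ht]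
    refine HasDerivWithinAt.congr_of_eventuallyEq_of_mem
      ((hL.eulerLagrange_iff (uniqueDiffOn_unitInterval t htI) (hmem t htI) (hγ t htI)
        (hν t htI)).2 rfl) ?_ htI
    filter_upwards [hnear t htI ht] with σ hσ
    rw [hvel σ hσ.1 hσ.2, hback σ hσ.1 hσ.2]

/-- A geodesic has constant speed. -/
theorem IsGeodesic.apply_velocity (hF : IsFinslerMetric F) {c : ℝ → M} (hc : IsGeodesic F c)
    (he : e ∈ atlas (EuclideanSpace ℝ (Fin n)) M) (hmaps : MapsTo c (Icc 0 1) e.source) {t : ℝ}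
    (htI : t ∈ Icc (0 : ℝ) 1) : F (velocity c t) = F (velocity c 0) := by
  have hL := hF.isFinslerLagrangian_localEnergy he
  let γ : ℝ → EuclideanSpace ℝ (Fin n) := fun r => e (c r)
  have hE : ∀ τ ∈ Icc (0 : ℝ) 1, HasDerivWithinAt
      (fun τ => localEnergy F e (γ τ) (derivWithin γ (Icc 0 1) τ)) 0 (Icc 0 1) τ := by
    intro τ hτ
    obtain ⟨h1, h2⟩ := hc.hasDerivWithinAt hF he hτ (hmaps hτ)
    exact hL.hasDerivWithinAt_energy (uniqueDiffOn_unitInterval τ hτ) hτ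
      (e.map_source (hmaps hτ)) h1 h2 (hc.eulerLagrange e he τ hτ (hmaps hτ))
  have hconst := constant_of_derivWithin_zero
    (fun τ hτ => (hE τ hτ).differentiableWithinAt)
    (fun τ hτ => (hE τ (Ico_subset_Icc_self hτ)).derivWithin
      (uniqueDiffOn_unitInterval τ (Ico_subset_Icc_self hτ))) t htI
  have hvel : ∀ τ ∈ Icc (0 : ℝ) 1,
      localEnergy F e (γ τ) (derivWithin γ (Icc 0 1) τ) = 1 / 2 * F (velocity c τ) ^ 2 := by
    intro τ hτ
    rw [localEnergy_eq, velocity_eq_chartVector he (hc.contMDiffOn τ hτ) hτ (hmaps hτ)]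
  rw [hvel t htI, hvel 0 (by simp)] at hconst
  have h1 := hF.nonneg (velocity c t)
  have h2 := hF.nonneg (velocity c 0)
  exact (sq_eq_sq₀ h1 h2).1 (by linarith)

theorem IsGeodesic.length_eq (hF : IsFinslerMetric F) {c : ℝ → M} (hc : IsGeodesic F c)
    (he : e ∈ atlas (EuclideanSpace ℝ (Fin n)) M) (hmaps : MapsTo c (Icc 0 1) e.source) :
    length F c = F (velocity c 0) := by
  have : length F c = ∫ _ in (0 : ℝ)..1, F (velocity c 0) := by
    refine intervalIntegral.integral_congr fun t ht => ?_
    rw [uIcc_of_le zero_le_one] at ht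
    exact hc.apply_velocity hF he hmaps ht
  rw [this]; simp

end ChartCurves

/-! ### Existence and uniqueness of geodesics in a spray chart -/

section SprayChart

open scoped unitInterval

variable {n : ℕ} {M : Type*} [TopologicalSpace M] [ChartedSpace (EuclideanSpace ℝ (Fin n)) M]

/-- A chart `e` of `M`, and a ball in it on which the geodesic equation of `F` agrees with the
equation of a globally defined field `f`; `ρ` bounds the velocities for which the geodesics stay
in the ball. -/
structure IsSprayChart (F : TangentBundle (𝓡 n) M → ℝ)
    (e : OpenPartialHomeomorph M (EuclideanSpace ℝ (Fin n)))
    (f : C(EuclideanSpace ℝ (Fin n) × EuclideanSpace ℝ (Fin n), EuclideanSpace ℝ (Fin n)))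
    (C R ρ : ℝ) (u₀ : EuclideanSpace ℝ (Fin n)) : Prop where
  mem_atlas : e ∈ atlas (EuclideanSpace ℝ (Fin n)) M
  field : IsQuadraticField f C
  mul_le : C * ρ ≤ 1 / 4
  pos : 0 < ρ
  le_half : ρ ≤ R / 2
  subset_target : Metric.closedBall u₀ R ⊆ e.target
  eq_spray : ∀ u ∈ Metric.closedBall u₀ R, ∀ w, f (u, w) = spray (localEnergy F e) (u, w)

variable {F : TangentBundle (𝓡 n) M → ℝ}

theorem IsFinslerMetric.exists_isSprayChart [IsManifold (𝓡 n) ∞ M] (hF : IsFinslerMetric F) (x : M) :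
    ∃ f C R ρ, IsSprayChart F (chartAt (EuclideanSpace ℝ (Fin n)) x) f C R ρ
      (chartAt (EuclideanSpace ℝ (Fin n)) x x) := by
  have he := chart_mem_atlas (EuclideanSpace ℝ (Fin n)) x
  have hL := hF.isFinslerLagrangian_localEnergy he
  obtain ⟨f, C, R, hf, hR, hsub, heq⟩ := exists_isQuadraticField hL.isOpen hL.contDiffOn_spray
    (fun u hu w a ha => hL.spray_smul hu w ha) (mem_chart_target _ x)
  have hC := hf.one_le
  -- The first bound on ρ makes the Picard map contract, the second keeps the solutions in the ball
  -- where f is the spray.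
  refine ⟨f, C, R, min (1 / (4 * C)) (R / 2), he, hf, ?_, by positivity, min_le_right _ _, hsub,
    heq⟩
  calc C * min (1 / (4 * C)) (R / 2) ≤ C * (1 / (4 * C)) := by gcongr; exact min_le_left _ _
    _ = 1 / 4 := by field_simp

/-- The solution of the geodesic equation in the chart `e`, as a curve in `M`. -/
noncomputable def chartGeodesic (e : OpenPartialHomeomorph M (EuclideanSpace ℝ (Fin n)))
    (f : C(EuclideanSpace ℝ (Fin n) × EuclideanSpace ℝ (Fin n), EuclideanSpace ℝ (Fin n)))
    (ρ : ℝ) (u w : EuclideanSpace ℝ (Fin n)) (t : ℝ) : M :=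
  e.symm (u + extendPath (volterra (EuclideanSpace ℝ (Fin n)) (velocityPath f ρ u w)) t)

namespace IsSprayChart

variable {e : OpenPartialHomeomorph M (EuclideanSpace ℝ (Fin n))}
  {f : C(EuclideanSpace ℝ (Fin n) × EuclideanSpace ℝ (Fin n), EuclideanSpace ℝ (Fin n))}
  {C R ρ : ℝ} {u₀ u w : EuclideanSpace ℝ (Fin n)}

theorem norm_velocityPath_le (h : IsSprayChart F e f C R ρ u₀) (hw : ‖w‖ ≤ ρ / 2) :
    ‖velocityPath f ρ u w‖ ≤ 2 / 3 * ρ := by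
  have := h.field.norm_velocityPath_le (u := u) h.mul_le hw
  linarith

/-- The curve moves at most 2ρ/3 ≤ R/3 away from a starting point in the ball of radius R/2. -/
theorem position_mem_ball (h : IsSprayChart F e f C R ρ u₀) (hu : u ∈ Metric.ball u₀ (R / 2))
    (hw : ‖w‖ ≤ ρ / 2) (t : ℝ) :
    u + extendPath (volterra _ (velocityPath f ρ u w)) t ∈ Metric.ball u₀ R := by
  rw [Metric.mem_ball, dist_eq_norm] at hu ⊢
  have h1 := (norm_extendPath_le (volterra _ (velocityPath f ρ u w)) t).trans
    ((norm_volterra_le _).trans (h.norm_velocityPath_le hw))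
  have h2 := norm_add_le (u - u₀) (extendPath (volterra _ (velocityPath f ρ u w)) t)
  have h3 := h.le_half
  have h4 := h.pos
  have h5 : u + extendPath (volterra _ (velocityPath f ρ u w)) t - u₀ =
    u - u₀ + extendPath (volterra _ (velocityPath f ρ u w)) t := by abel
  rw [h5]
  linarith

theorem position_mem_target (h : IsSprayChart F e f C R ρ u₀) (hu : u ∈ Metric.ball u₀ (R / 2))
    (hw : ‖w‖ ≤ ρ / 2) (t : ℝ) :
    u + extendPath (volterra _ (velocityPath f ρ u w)) t ∈ e.target :=
  h.subset_target (Metric.ball_subset_closedBall (h.position_mem_ball hu hw t))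

theorem chart_chartGeodesic (h : IsSprayChart F e f C R ρ u₀) (hu : u ∈ Metric.ball u₀ (R / 2))
    (hw : ‖w‖ ≤ ρ / 2) (t : ℝ) : e (chartGeodesic e f ρ u w t) =
      u + extendPath (volterra _ (velocityPath f ρ u w)) t :=
  e.right_inv (h.position_mem_target hu hw t)

theorem chartGeodesic_mem_source (h : IsSprayChart F e f C R ρ u₀)
    (hu : u ∈ Metric.ball u₀ (R / 2)) (hw : ‖w‖ ≤ ρ / 2) (t : ℝ) :
    chartGeodesic e f ρ u w t ∈ e.source :=
  e.map_target (h.position_mem_target hu hw t)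

theorem chartGeodesic_eq (h : IsSprayChart F e f C R ρ u₀) (hw : ‖w‖ ≤ ρ / 2) {t : ℝ}
    (ht : t ∈ Icc (0 : ℝ) 1) :
    chartGeodesic e f ρ u w t = e.symm (timeOneMap f ρ u (t • w)) := by
  rw [h.field.timeOneMap_smul h.mul_le hw ht]
  rfl

theorem chartGeodesic_zero (h : IsSprayChart F e f C R ρ u₀) (hw : ‖w‖ ≤ ρ / 2) :
    chartGeodesic e f ρ u w 0 = e.symm u := by
  rw [h.chartGeodesic_eq hw (by simp), zero_smul,
    h.field.timeOneMap_zero_right h.mul_le h.pos.le]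

theorem derivWithin_chart_chartGeodesic (h : IsSprayChart F e f C R ρ u₀)
    (hu : u ∈ Metric.ball u₀ (R / 2)) (hw : ‖w‖ ≤ ρ / 2) {t : ℝ} (ht : t ∈ Icc (0 : ℝ) 1) :
    derivWithin (fun r => e (chartGeodesic e f ρ u w r)) (Icc 0 1) t =
      extendPath (velocityPath f ρ u w) t := by
  have h1 : (fun r => e (chartGeodesic e f ρ u w r)) =
      fun r => u + extendPath (volterra _ (velocityPath f ρ u w)) r :=
    funext (h.chart_chartGeodesic hu hw)
  rw [h1]
  exact (IsQuadraticField.hasDerivWithinAt_position f ρ u w ht).derivWithin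
    (uniqueDiffOn_unitInterval t ht)

variable [IsManifold (𝓡 n) ∞ M]

theorem isGeodesic_chartGeodesic (h : IsSprayChart F e f C R ρ u₀) (hF : IsFinslerMetric F)
    (hu : u ∈ Metric.ball u₀ (R / 2)) (hw : ‖w‖ ≤ ρ / 2) :
    IsGeodesic F (chartGeodesic e f ρ u w) := by
  have h1 := fun t (ht : t ∈ Icc (0 : ℝ) 1) =>
    IsQuadraticField.hasDerivWithinAt_position f ρ u w ht
  have h2 := fun t (ht : t ∈ Icc (0 : ℝ) 1) =>
    h.field.hasDerivWithinAt_velocityPath (u := u) h.mul_le hw ht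
  -- Bootstrapping: the equation expresses the derivative of the velocity as a continuous function,
  -- so the velocity is C¹ and the position C².
  have hC1 : ContDiffOn ℝ 1 (extendPath (velocityPath f ρ u w)) (Icc 0 1) := by
    rw [show (1 : ℕ∞ω) = 0 + 1 from rfl, contDiffOn_succ_iff_derivWithin uniqueDiffOn_unitInterval]
    refine ⟨fun t ht => (h2 t ht).differentiableWithinAt, by simp, contDiffOn_zero.2 ?_⟩
    refine ContinuousOn.congr (Continuous.continuousOn ?_)
      fun t ht => (h2 t ht).derivWithin (uniqueDiffOn_unitInterval t ht)
    exact f.continuous.comp ((continuous_const.add (continuous_extendPath _)).prodMk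
      (continuous_extendPath _))
  have hC2 : ContDiffOn ℝ 2
      (fun t => u + extendPath (volterra _ (velocityPath f ρ u w)) t) (Icc 0 1) := by
    rw [show (2 : ℕ∞ω) = 1 + 1 by norm_num,
      contDiffOn_succ_iff_derivWithin uniqueDiffOn_unitInterval]
    exact ⟨fun t ht => (h1 t ht).differentiableWithinAt, by simp,
      hC1.congr fun t ht => (h1 t ht).derivWithin (uniqueDiffOn_unitInterval t ht)⟩
  refine isGeodesic_of_hasDerivWithinAt hF h.mem_atlas hC2
    (fun t _ => h.position_mem_target hu hw t) h1 fun t ht => ?_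
  rw [← h.eq_spray _ (Metric.ball_subset_closedBall (h.position_mem_ball hu hw t))]
  exact h2 t ht

theorem velocity_chartGeodesic (h : IsSprayChart F e f C R ρ u₀) (hF : IsFinslerMetric F)
    (hu : u ∈ Metric.ball u₀ (R / 2)) (hw : ‖w‖ ≤ ρ / 2) :
    velocity (chartGeodesic e f ρ u w) 0 = chartVector e (u, w) := by
  have h0 : (0 : ℝ) ∈ Icc (0 : ℝ) 1 := by simp
  rw [velocity_eq_chartVector h.mem_atlas
    ((h.isGeodesic_chartGeodesic hF hu hw).contMDiffOn 0 h0) h0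
    (h.chartGeodesic_mem_source hu hw 0), h.derivWithin_chart_chartGeodesic hu hw h0,
    h.chart_chartGeodesic hu hw, extendPath_of_mem _ h0, extendPath_of_mem _ h0]
  congr 2
  · exact (congrArg (u + ·) (volterra_zero _)).trans (add_zero u)
  · exact h.field.velocityPath_apply_zero h.mul_le hw

/-- A geodesic that runs in the ball with small velocities is determined by its initial
velocity. -/
theorem eqOn_of_velocity_eq [T2Space M] (h : IsSprayChart F e f C R ρ u₀)
    (hF : IsFinslerMetric F) {c c' : ℝ → M} (hc : IsGeodesic F c) (hc' : IsGeodesic F c')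
    (hsrc : ∀ t ∈ Icc (0 : ℝ) 1, c t ∈ e.source)
    (hball : ∀ t ∈ Icc (0 : ℝ) 1, e (c t) ∈ Metric.ball u₀ R)
    (hspeed : ∀ t ∈ Icc (0 : ℝ) 1, ‖derivWithin (fun r => e (c r)) (Icc 0 1) t‖ < 1)
    (hvel : velocity (n := n) c' 0 = velocity c 0) : EqOn c' c (Icc 0 1) := by
  have he := h.mem_atlas
  have h00 : (0 : ℝ) ∈ Icc (0 : ℝ) 1 := by simp
  have hinit : c' 0 = c 0 := congrArg (fun X : TangentBundle (𝓡 n) M => X.1) hvel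
  let ν := derivWithin (fun r => e (c r)) (Icc 0 1)
  let ν' := derivWithin (fun r => e (c' r)) (Icc 0 1)
  -- Continuity argument: nothing confines c' to the chart in advance, but while it agrees with c it
  -- stays in the chart with small velocity, and does so a little longer.
  let s : Set ℝ := {t | EqOn c' c (Icc 0 t)}
  have hclosed : IsClosed (s ∩ Icc 0 1) := by
    have hZ : IsClosed {t | t ∈ Icc (0 : ℝ) 1 ∧ c' t = c t} := by
      have hcc := hc.contMDiffOn.continuousOn
      have hcc' := hc'.contMDiffOn.continuousOn
      have := (hcc'.prodMk hcc).preimage_isClosed_of_isClosed isClosed_Icc isClosed_diagonal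
      exact this
    rw [← isSeqClosed_iff_isClosed]
    intro t a ht hta
    have haI : a ∈ Icc (0 : ℝ) 1 := isClosed_Icc.mem_of_tendsto hta
      (Filter.Eventually.of_forall fun k => (ht k).2)
    refine ⟨fun τ hτ => ?_, haI⟩
    rcases hτ.2.eq_or_lt with rfl | hlt
    · refine (hZ.mem_of_tendsto hta (Filter.Eventually.of_forall fun k => ⟨(ht k).2, ?_⟩)).2
      exact (ht k).1 ⟨(ht k).2.1, le_rfl⟩
    · obtain ⟨k, hk⟩ := (hta.eventually (lt_mem_nhds hlt)).exists
      exact (ht k).1 ⟨hτ.1, hk.le⟩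
  have hzero : (0 : ℝ) ∈ s := by
    intro τ hτ
    rw [Icc_self, mem_singleton_iff] at hτ
    rw [hτ, hinit]
  have hstep : ∀ t ∈ s ∩ Ico 0 1, ∀ y ∈ Ioi t, (s ∩ Ioc t y).Nonempty := by
    rintro t ⟨hts, ht⟩ y hy
    have htI : t ∈ Icc (0 : ℝ) 1 := Ico_subset_Icc_self ht
    have hct : c' t = c t := hts ⟨ht.1, le_rfl⟩
    have hct' : c' t ∈ e.source := hct ▸ hsrc t htI
    obtain ⟨hd1, hd2⟩ := hc.hasDerivWithinAt hF he htI (hsrc t htI)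
    obtain ⟨hd1', hd2'⟩ := hc'.hasDerivWithinAt hF he htI hct'
    -- At t = 0 this is the hypothesis; for t > 0 both velocities are left derivatives of curves
    -- that agree on [0, t].
    have hνt : ν' t = ν t := by
      rcases ht.1.eq_or_lt with rfl | hpos
      · have h1 := chartCoord_velocity he (hc'.contMDiffOn 0 h00) h00 hct'
        have h2 := chartCoord_velocity he (hc.contMDiffOn 0 h00) h00 (hsrc 0 h00)
        rw [hvel, h2] at h1
        exact (congrArg Prod.snd h1).symm
      · have hsub : Icc 0 t ⊆ Icc (0 : ℝ) 1 := Icc_subset_Icc_right ht.2.le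
        refine (uniqueDiffOn_Icc hpos t ⟨hpos.le, le_rfl⟩).eq_deriv _ (hd1'.mono hsub) ?_
        exact (hd1.mono hsub).congr (fun τ hτ => by rw [hts hτ]) (by rw [hct])
    have hgood : ∀ᶠ τ in 𝓝[Icc 0 1] t, τ ∈ Icc (0 : ℝ) 1 ∧ c' τ ∈ e.source ∧
        e (c' τ) ∈ Metric.ball u₀ R ∧ ‖ν' τ‖ < 1 := by
      refine Filter.Eventually.and self_mem_nhdsWithin (Filter.Eventually.and ?_
        (Filter.Eventually.and ?_ ?_))
      · exact (hc'.contMDiffOn.continuousOn t htI).eventually (e.open_source.mem_nhds hct')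
      · refine hd1'.continuousWithinAt.eventually (Metric.isOpen_ball.mem_nhds ?_)
        change e (c' t) ∈ _
        rw [hct]
        exact hball t htI
      · refine hd2'.continuousWithinAt.norm.eventually (Iio_mem_nhds ?_)
        change ‖ν' t‖ < 1
        rw [hνt]
        exact hspeed t htI
    have hIcc : ∀ τ ∈ Ico (0 : ℝ) 1, Icc (0 : ℝ) 1 ∈ 𝓝[≥] τ := fun τ hτ =>
      Icc_mem_nhdsGE_of_mem hτ
    obtain ⟨b, hb, hbsub⟩ := mem_nhdsGE_iff_exists_Icc_subset.1
      (nhdsWithin_le_of_mem (hIcc t ht) hgood)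
    have htb : t < min b y := lt_min hb hy
    have hb1 : ∀ τ ∈ Ico t (min b y), τ ∈ Ico (0 : ℝ) 1 := fun τ hτ =>
      ⟨ht.1.trans hτ.1, (hτ.2.trans_le (min_le_left _ _)).trans_le
        (hbsub ⟨hb.le, le_rfl⟩).1.2⟩
    have hmem : ∀ τ ∈ Icc t (min b y), τ ∈ Icc t b := fun τ hτ =>
      ⟨hτ.1, hτ.2.trans (min_le_left _ _)⟩
    have hsys : ∀ {γ : ℝ → M}, IsGeodesic F γ →
        (∀ τ ∈ Icc t (min b y), τ ∈ Icc (0 : ℝ) 1 ∧ γ τ ∈ e.source ∧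
          e (γ τ) ∈ Metric.ball u₀ R) →
        ContinuousOn (fun τ => (e (γ τ), derivWithin (fun r => e (γ r)) (Icc 0 1) τ))
          (Icc t (min b y)) ∧
        ∀ τ ∈ Ico t (min b y), HasDerivWithinAt
          (fun τ => (e (γ τ), derivWithin (fun r => e (γ r)) (Icc 0 1) τ))
          (derivWithin (fun r => e (γ r)) (Icc 0 1) τ,
            f (e (γ τ), derivWithin (fun r => e (γ r)) (Icc 0 1) τ)) (Ici τ) τ := by
      intro γ hγ hγt
      have hder : ∀ τ ∈ Icc t (min b y), HasDerivWithinAt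
          (fun τ => (e (γ τ), derivWithin (fun r => e (γ r)) (Icc 0 1) τ))
          (derivWithin (fun r => e (γ r)) (Icc 0 1) τ,
            f (e (γ τ), derivWithin (fun r => e (γ r)) (Icc 0 1) τ)) (Icc 0 1) τ := by
        intro τ hτ
        obtain ⟨hτ1, hτ2, hτ3⟩ := hγt τ hτ
        obtain ⟨h1, h2⟩ := hγ.hasDerivWithinAt hF he hτ1 hτ2
        rw [← h.eq_spray _ (Metric.ball_subset_closedBall hτ3)] at h2
        exact h1.prodMk h2
      exact ⟨fun τ hτ => (hder τ hτ).continuousWithinAt.mono fun r hr => (hγt r hr).1,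
        fun τ hτ => (hder τ (Ico_subset_Icc_self hτ)).mono_of_mem_nhdsWithin
          (hIcc τ (hb1 τ hτ))⟩
    have hgood' := fun τ (hτ : τ ∈ Icc t (min b y)) => hbsub (hmem τ hτ)
    obtain ⟨hcont, hder⟩ := hsys hc fun τ hτ =>
      ⟨(hgood' τ hτ).1, hsrc τ (hgood' τ hτ).1, hball τ (hgood' τ hτ).1⟩
    obtain ⟨hcont', hder'⟩ := hsys hc' fun τ hτ =>
      ⟨(hgood' τ hτ).1, (hgood' τ hτ).2.1, (hgood' τ hτ).2.2.1⟩
    -- The estimate for f with ρ = 1 holds only on the slab ‖z.2‖ ≤ 1, hence the speed condition; C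
    -- + 1 also dominates the constant 1 of the first component.
    have hlip : ∀ τ ∈ Ico t (min b y), LipschitzOnWith (Real.toNNReal (C + 1))
        (fun z : EuclideanSpace ℝ (Fin n) × EuclideanSpace ℝ (Fin n) => (z.2, f z))
        {z | ‖z.2‖ ≤ 1} := by
      intro τ _
      refine LipschitzOnWith.of_dist_le_mul fun z hz z' hz' => ?_
      rw [Real.coe_toNNReal _ (by linarith [h.field.nonneg]), dist_eq_norm, dist_eq_norm]
      have h1 := h.field.lipschitz 1 z z' le_rfl hz hz'
      have h2 : ‖z.2 - z'.2‖ ≤ ‖z - z'‖ := norm_snd_le (z - z')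
      have h3 := mul_nonneg h.field.nonneg (norm_nonneg (z - z'))
      refine max_le ?_ ?_
      · change ‖z.2 - z'.2‖ ≤ _
        linarith [norm_nonneg (z - z')]
      · change ‖f z - f z'‖ ≤ _
        linarith [norm_nonneg (z - z')]
    have huniq := ODE_solution_unique_of_mem_Icc_right hlip hcont' hder'
      (fun τ hτ => (hgood' τ (Ico_subset_Icc_self hτ)).2.2.2.le) hcont hder
      (fun τ hτ => (hspeed τ (hgood' τ (Ico_subset_Icc_self hτ)).1).le)
      (Prod.ext (congrArg e hct) hνt)
    refine ⟨min b y, fun τ hτ => ?_, htb, min_le_right _ _⟩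
    rcases le_total τ t with hτt | hτt
    · exact hts ⟨hτ.1, hτt⟩
    · have h1 := hgood' τ ⟨hτt, hτ.2⟩
      exact e.injOn h1.2.1 (hsrc τ h1.1) (congrArg Prod.fst (huniq ⟨hτt, hτ.2⟩))
  have := hclosed.Icc_subset_of_forall_exists_gt hzero hstep
  exact fun t ht => this (right_mem_Icc.2 zero_le_one) ht

end IsSprayChart

end SprayChart

/-! ### The exponential map in a spray chart -/

section ExponentialMap

variable {n : ℕ} {M : Type*} [TopologicalSpace M] [ChartedSpace (EuclideanSpace ℝ (Fin n)) M]

theorem isDiffeoOn_of_eqOn {k : ℕ∞ω} {E : EuclideanSpace ℝ (Fin n) → M}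
    {s : Set (EuclideanSpace ℝ (Fin n))} (Φ : OpenPartialHomeomorph (EuclideanSpace ℝ (Fin n)) M)
    (hE : EqOn E Φ s) (hs : IsOpen s) (hsub : s ⊆ Φ.source)
    (hΦ : ContMDiffOn (𝓡 n) (𝓡 n) k Φ s) (hΦ' : ContMDiffOn (𝓡 n) (𝓡 n) k Φ.symm (Φ '' s)) :
    IsDiffeoOn k E s := by
  refine ⟨hs, ?_, hΦ.congr hE, Φ.symm, fun v hv => ?_, ?_⟩
  · rw [hE.image_eq]
    exact Φ.isOpen_image_of_subset_source hs hsub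
  · rw [hE hv, Φ.left_inv (hsub hv)]
  · rwa [hE.image_eq]

theorem IsExpDiffeo.injOn {F : TangentBundle (𝓡 n) M → ℝ} {x : M} {r : ℝ}
    (h : IsExpDiffeo F x r) : InjOn (expAt F x) (indicatrix F x r) := by
  obtain ⟨g, hg, -⟩ := h.diffeo_one.2.2.2
  exact hg.injOn

theorem IsExpDiffeo.isOpen_expBall {F : TangentBundle (𝓡 n) M → ℝ} {x : M} {r : ℝ}
    (h : IsExpDiffeo F x r) : IsOpen (expBall F x r) :=
  h.diffeo_one.2.1

variable {F : TangentBundle (𝓡 n) M → ℝ}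
  {e : OpenPartialHomeomorph M (EuclideanSpace ℝ (Fin n))}
  {f : C(EuclideanSpace ℝ (Fin n) × EuclideanSpace ℝ (Fin n), EuclideanSpace ℝ (Fin n))}
  {C R ρ : ℝ} {u₀ u w : EuclideanSpace ℝ (Fin n)}

namespace IsSprayChart

theorem timeOneMap_mem_ball (h : IsSprayChart F e f C R ρ u₀)
    (hu : u ∈ Metric.ball u₀ (R / 2)) (hw : ‖w‖ ≤ ρ / 2) :
    timeOneMap f ρ u w ∈ Metric.ball u₀ R := by
  have h1 := h.position_mem_ball hu hw 1
  rwa [← h.field.timeOneMap_smul h.mul_le hw (by simp), one_smul] at h1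

variable [IsManifold (𝓡 n) ∞ M]

theorem chartVector_mem_expDomain (h : IsSprayChart F e f C R ρ u₀) (hF : IsFinslerMetric F)
    (hu : u ∈ Metric.ball u₀ (R / 2)) (hw : ‖w‖ ≤ ρ / 2) :
    chartVector e (u, w) ∈ expDomain F :=
  ⟨_, h.isGeodesic_chartGeodesic hF hu hw, h.velocity_chartGeodesic hF hu hw⟩

theorem mem_expDomain (h : IsSprayChart F e f C R ρ u₀) (hF : IsFinslerMetric F) {y : M}
    (hy : y ∈ e.source) (hu : e y ∈ Metric.ball u₀ (R / 2)) {v : EuclideanSpace ℝ (Fin n)}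
    (hv : ‖chartDeriv e y v‖ ≤ ρ / 2) : tangentVector y v ∈ expDomain F := by
  rw [← chartVector_chartDeriv h.mem_atlas hy v]
  exact h.chartVector_mem_expDomain hF hu hv

variable [T2Space M]

theorem eqOn_chartGeodesic (h : IsSprayChart F e f C R ρ u₀) (hF : IsFinslerMetric F)
    (hu : u ∈ Metric.ball u₀ (R / 2)) (hw : ‖w‖ ≤ ρ / 2) {c : ℝ → M} (hc : IsGeodesic F c)
    (hvel : velocity c 0 = chartVector e (u, w)) :
    EqOn c (chartGeodesic e f ρ u w) (Icc 0 1) := by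
  refine h.eqOn_of_velocity_eq hF (h.isGeodesic_chartGeodesic hF hu hw) hc
    (fun t _ => h.chartGeodesic_mem_source hu hw t) (fun t _ => ?_) (fun t ht => ?_)
    (hvel.trans (h.velocity_chartGeodesic hF hu hw).symm)
  · rw [h.chart_chartGeodesic hu hw]
    exact h.position_mem_ball hu hw t
  · rw [h.derivWithin_chart_chartGeodesic hu hw ht]
    have h1 := (norm_extendPath_le (velocityPath f ρ u w) t).trans (h.norm_velocityPath_le hw)
    have h2 := h.field.le_one h.mul_le
    linarith

/-- `Exp` evaluates a chosen geodesic; uniqueness on [0,1] makes the choice immaterial. -/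
theorem exp_chartVector (h : IsSprayChart F e f C R ρ u₀) (hF : IsFinslerMetric F)
    (hu : u ∈ Metric.ball u₀ (R / 2)) (hw : ‖w‖ ≤ ρ / 2) :
    Exp F (chartVector e (u, w)) = e.symm (timeOneMap f ρ u w) := by
  have hex : ∃ c : ℝ → M, IsGeodesic F c ∧ velocity c 0 = chartVector e (u, w) :=
    h.chartVector_mem_expDomain hF hu hw
  rw [Exp, dif_pos hex, h.eqOn_chartGeodesic hF hu hw hex.choose_spec.1 hex.choose_spec.2
    (right_mem_Icc.2 zero_le_one), h.chartGeodesic_eq hw (by simp), one_smul]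

theorem expAt_eq (h : IsSprayChart F e f C R ρ u₀) (hF : IsFinslerMetric F) {y : M}
    (hy : y ∈ e.source) (hu : e y ∈ Metric.ball u₀ (R / 2)) {v : EuclideanSpace ℝ (Fin n)}
    (hv : ‖chartDeriv e y v‖ ≤ ρ / 2) :
    expAt F y v = e.symm (timeOneMap f ρ (e y) (chartDeriv e y v)) := by
  rw [← h.exp_chartVector hF hu hv, chartVector_chartDeriv h.mem_atlas hy v]
  rfl

/-- The exponential map at `y` is a diffeomorphism on the indicatrices that are small in the
chart. -/
theorem isExpDiffeo (h : IsSprayChart F e f C R ρ u₀) (hF : IsFinslerMetric F) {y : M}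
    (hy : y ∈ e.source) (hu : e y ∈ Metric.ball u₀ (R / 2)) {r : ℝ}
    (hr : ∀ v ∈ indicatrix F y r, ‖chartDeriv e y v‖ < ρ / 2) : IsExpDiffeo F y r := by
  have he := h.mem_atlas
  have hopen : IsOpen (indicatrix F y r) := by
    have h1 : Continuous fun v => F (chartVector e (e y, chartDeriv e y v)) :=
      (hF.continuousOn_chartMetric he).comp_continuous
        (continuous_const.prodMk (chartDeriv e y).continuous)
        fun v => ⟨e.map_source hy, mem_univ _⟩
    have h2 : indicatrix F y r = {v | F (chartVector e (e y, chartDeriv e y v)) < r} := by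
      ext v
      rw [mem_ofPred_eq, chartVector_chartDeriv he hy]
      rfl
    rw [h2]
    exact isOpen_lt h1 continuous_const
  obtain ⟨φ, hφ, hsrc, hφ1, hφ2, -⟩ := h.field.exists_openPartialHomeomorph (u := e y) h.mul_le
  let A := chartDerivEquiv he hy
  have hA : ∀ v, A v = chartDeriv e y v := fun _ => rfl
  let Φ : OpenPartialHomeomorph (EuclideanSpace ℝ (Fin n)) M :=
    A.toHomeomorph.toOpenPartialHomeomorph.trans (φ.trans e.symm)
  have hΦ : ∀ v, Φ v = e.symm (φ (A v)) := fun _ => rfl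
  have hΦ' : ∀ z, Φ.symm z = A.symm (φ.symm (e z)) := fun _ => rfl
  have hmemφ : ∀ v ∈ indicatrix F y r, A v ∈ φ.source := by
    intro v hv
    rw [hsrc, mem_ball_zero_iff]
    exact hr v hv
  have hmeme : ∀ v ∈ indicatrix F y r, φ (A v) ∈ e.target := by
    intro v hv
    rw [hφ]
    exact h.subset_target (Metric.ball_subset_closedBall
      (h.timeOneMap_mem_ball hu (hr v hv).le))
  have hsub : indicatrix F y r ⊆ Φ.source := fun v hv =>
    ⟨mem_univ _, hmemφ v hv, hmeme v hv⟩
  have hE : EqOn (expAt F y) Φ (indicatrix F y r) := by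
    intro v hv
    rw [h.expAt_eq hF hy hu (hr v hv).le, hΦ, hφ, hA]
  have he1 : ContMDiffOn (𝓡 n) (𝓡 n) ∞ e e.source :=
    contMDiffOn_of_mem_maximalAtlas (IsManifold.subset_maximalAtlas he)
  have he2 : ContMDiffOn (𝓡 n) (𝓡 n) ∞ e.symm e.target :=
    contMDiffOn_symm_of_mem_maximalAtlas (IsManifold.subset_maximalAtlas he)
  -- The outer factors of Φ, the chart inverse and the linear A, are smooth, so the class of Exp and
  -- of its inverse is that of φ and `φ.symm`: C¹ throughout, smooth off zero.
  have key : ∀ (k : ℕ∞ω) (s : Set (EuclideanSpace ℝ (Fin n))), k ≤ ∞ → IsOpen s →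
      s ⊆ indicatrix F y r → (∀ v ∈ s, ContDiffAt ℝ k φ (A v)) →
      (∀ v ∈ s, ContDiffAt ℝ k φ.symm (φ (A v))) → IsDiffeoOn k (expAt F y) s := by
    intro k s hk hs hsr h1 h2
    refine isDiffeoOn_of_eqOn Φ (hE.mono hsr) hs (hsr.trans hsub) ?_ ?_
    · intro v hv
      have h3 : ContMDiffAt (𝓡 n) (𝓡 n) k (fun v => φ (A v)) v :=
        ((h1 v hv).comp v A.contDiff.contDiffAt).contMDiffAt
      exact (((he2.of_le hk).contMDiffAt
        (e.open_target.mem_nhds (hmeme v (hsr hv)))).comp v h3).contMDiffWithinAt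
    · rintro _ ⟨v, hv, rfl⟩
      have h4 : e (Φ v) = φ (A v) := e.right_inv (hmeme v (hsr hv))
      have h3 : ContMDiffAt (𝓡 n) (𝓡 n) k (fun z => A.symm (φ.symm z)) (e (Φ v)) := by
        rw [h4]
        exact (A.symm.contDiff.contDiffAt.comp _ (h2 v hv)).contMDiffAt
      exact (h3.comp (Φ v) ((he1.of_le hk).contMDiffAt (e.open_source.mem_nhds
        (e.map_target (hmeme v (hsr hv)))))).contMDiffWithinAt
  refine ⟨fun v hv => h.mem_expDomain hF hy hu (hr v hv).le, ?_, ?_⟩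
  · refine key 1 _ (by simp) hopen subset_rfl (fun v hv => ?_) fun v hv => ?_
    · rw [hφ]
      exact h.field.contDiffAt_one_timeOneMap h.mul_le (hr v hv)
    · exact hφ1 _ (φ.map_source (hmemφ v hv))
  · refine key ∞ _ le_rfl (hopen.sdiff isClosed_singleton) sdiff_subset (fun v hv => ?_)
      fun v hv => ?_
    · rw [hφ]
      exact h.field.contDiffAt_timeOneMap h.mul_le (hr v hv.1)
        ((map_ne_zero_iff A A.injective).2 hv.2)
    · refine hφ2 _ (φ.map_source (hmemφ v hv.1)) ?_
      rw [φ.left_inv (hmemφ v hv.1)]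
      exact (map_ne_zero_iff A A.injective).2 hv.2

theorem expAt_zero (h : IsSprayChart F e f C R ρ u₀) (hF : IsFinslerMetric F) {y : M}
    (hy : y ∈ e.source) (hu : e y ∈ Metric.ball u₀ (R / 2)) : expAt F y 0 = y := by
  have := h.pos
  rw [h.expAt_eq hF hy hu (by simp; positivity), map_zero,
    h.field.timeOneMap_zero_right h.mul_le this.le, e.left_inv hy]

end IsSprayChart

theorem IsFinslerMetric.zero_mem_indicatrix [IsManifold (𝓡 n) ∞ M] (hF : IsFinslerMetric F)
    (y : M) {r : ℝ} (hr : 0 < r) : 0 ∈ indicatrix F y r :=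
  (hF.apply_zero y).trans_lt hr

end ExponentialMap

/-! ### Choice of radii and the convex neighbourhoods -/

section ConvexNeighbourhoods

variable {n : ℕ} {M : Type*} [TopologicalSpace M] [ChartedSpace (EuclideanSpace ℝ (Fin n)) M]
  {F : TangentBundle (𝓡 n) M → ℝ}
  {e : OpenPartialHomeomorph M (EuclideanSpace ℝ (Fin n))}
  {f : C(EuclideanSpace ℝ (Fin n) × EuclideanSpace ℝ (Fin n), EuclideanSpace ℝ (Fin n))}
  {C R ρ : ℝ} {u₀ : EuclideanSpace ℝ (Fin n)}

theorem IsQuadraticField.norm_timeOneMap_sub_le (hf : IsQuadraticField f C) (hρ : C * ρ ≤ 1 / 4)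
    {u w : EuclideanSpace ℝ (Fin n)} (hw : ‖w‖ ≤ ρ / 2) :
    ‖timeOneMap f ρ u w - u‖ ≤ 4 / 3 * ‖w‖ := by
  have h1 := hf.timeOneMap_smul (u := u) hρ hw (right_mem_Icc.2 zero_le_one)
  rw [one_smul] at h1
  rw [h1, add_sub_cancel_left]
  exact (norm_extendPath_le _ _).trans ((norm_volterra_le _).trans (hf.norm_velocityPath_le hρ hw))

variable [IsManifold (𝓡 n) ∞ M]

/-- On a compact part of a chart, a Finsler metric is comparable to the Euclidean norm. -/
theorem IsFinslerMetric.exists_chartMetric_bounds (hF : IsFinslerMetric F)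
    (he : e ∈ atlas (EuclideanSpace ℝ (Fin n)) M) {K : Set (EuclideanSpace ℝ (Fin n))}
    (hK : IsCompact K) (hsub : K ⊆ e.target) :
    ∃ m B : ℝ, 0 < m ∧ 0 < B ∧ ∀ u ∈ K, ∀ w, m * ‖w‖ ≤ F (chartVector e (u, w)) ∧
      F (chartVector e (u, w)) ≤ B * ‖w‖ := by
  have hcont : ContinuousOn (fun z => F (chartVector e z)) (K ×ˢ {0}ᶜ) :=
    (hF.continuousOn_chartMetric he).mono (prod_mono hsub (subset_univ _))
  have hom : ∀ u ∈ K, ∀ w (a : ℝ), 0 < a →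
      F (chartVector e (u, a • w)) = a ^ 1 • F (chartVector e (u, w)) := fun u _ w a ha => by
    rw [hF.chartMetric_smul u w ha, pow_one, smul_eq_mul]
  obtain ⟨B, hB, hle⟩ := exists_norm_le_of_homogeneous hK hcont one_ne_zero hom
  obtain ⟨m, hm, hge⟩ := exists_le_norm_of_homogeneous hK hcont one_ne_zero hom
    fun u hu w hw => (hF.chartMetric_pos he (hsub hu) hw).ne'
  refine ⟨m, B, hm, hB, fun u hu w => ?_⟩
  have h1 := hle u hu w
  have h2 := hge u hu w
  rw [pow_one, Real.norm_of_nonneg (hF.nonneg _)] at h1 h2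
  exact ⟨h2, h1⟩

theorem IsFinslerMetric.smul_mem_indicatrix (hF : IsFinslerMetric F) {y : M} {r : ℝ}
    {v : EuclideanSpace ℝ (Fin n)} (hv : v ∈ indicatrix F y r) {t : ℝ} (ht : t ∈ Icc (0 : ℝ) 1) :
    t • v ∈ indicatrix F y r := by
  have h0 := hF.nonneg (tangentVector y v)
  have hv' : F (tangentVector y v) < r := hv
  rcases ht.1.eq_or_lt with rfl | hpos
  · rw [zero_smul]
    exact hF.zero_mem_indicatrix y (h0.trans_lt hv')
  · have h1 : F (tangentVector y (t • v)) = t * F (tangentVector y v) :=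
      hF.homogeneous y v t hpos
    change F (tangentVector y (t • v)) < r
    rw [h1]
    exact (mul_le_of_le_one_left h0 ht.2).trans_lt hv'

namespace IsSprayChart

variable [T2Space M]

theorem expBall_subset_source (h : IsSprayChart F e f C R ρ u₀) (hF : IsFinslerMetric F) {y : M}
    (hy : y ∈ e.source) (hu : e y ∈ Metric.ball u₀ (R / 2)) {r : ℝ}
    (hr : ∀ v ∈ indicatrix F y r, ‖chartDeriv e y v‖ < ρ / 2) : expBall F y r ⊆ e.source := by
  rintro _ ⟨v, hv, rfl⟩
  rw [h.expAt_eq hF hy hu (hr v hv).le]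
  exact e.map_target (h.subset_target (Metric.ball_subset_closedBall
    (h.timeOneMap_mem_ball hu (hr v hv).le)))

/-- If z = Exp_y(v), then t ↦ Exp_y(tv) stays in the ball because the indicatrix is star-shaped. A
competitor stays in the chart, so its length is the F-value of its initial vector v'; hence v' lies
in the indicatrix, Exp_y(v') = z, and injectivity gives v' = v. -/
theorem exists_isShortGeodesic (h : IsSprayChart F e f C R ρ u₀) (hF : IsFinslerMetric F) {y z : M}
    (hy : y ∈ e.source) (hu : e y ∈ Metric.ball u₀ (R / 2)) {r : ℝ}
    (hr : ∀ v ∈ indicatrix F y r, ‖chartDeriv e y v‖ < ρ / 2) (hz : z ∈ expBall F y r) :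
    ∃ c : ℝ → M, IsShortGeodesic F r y z c ∧
      ∀ c' : ℝ → M, IsShortGeodesic F r y z c' → EqOn c' c (Icc 0 1) := by
  have he := h.mem_atlas
  have hsource := h.expBall_subset_source hF hy hu hr
  obtain ⟨v, hv, rfl⟩ := hz
  have hw := (hr v hv).le
  let c := chartGeodesic e f ρ (e y) (chartDeriv e y v)
  have hc : IsGeodesic F c := h.isGeodesic_chartGeodesic hF hu hw
  have hct : ∀ t ∈ Icc (0 : ℝ) 1, c t = expAt F y (t • v) := by
    intro t ht
    rw [h.expAt_eq hF hy hu (hr _ (hF.smul_mem_indicatrix hv ht)).le, map_smul]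
    exact h.chartGeodesic_eq hw ht
  have hmaps : MapsTo c (Icc 0 1) (expBall F y r) := fun t ht =>
    ⟨_, hF.smul_mem_indicatrix hv ht, (hct t ht).symm⟩
  have hvel : velocity c 0 = tangentVector y v := by
    rw [← chartVector_chartDeriv he hy v]
    exact h.velocity_chartGeodesic hF hu hw
  refine ⟨c, ⟨hc, ?_, ?_, hmaps, ?_⟩, fun c' hc' => ?_⟩
  · exact (h.chartGeodesic_zero hw).trans (e.left_inv hy)
  · rw [hct 1 (by simp), one_smul]
  · rw [hc.length_eq hF he (hmaps.mono_right hsource), hvel]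
    exact hv
  · have hmaps' := hc'.mapsTo.mono_right hsource
    obtain ⟨v', hvel'⟩ : ∃ v', velocity c' 0 = tangentVector y v' := by
      rw [← hc'.source]
      exact ⟨(velocity (n := n) c' 0).2, rfl⟩
    have hv' : v' ∈ indicatrix F y r := by
      have := hc'.length_lt
      rwa [hc'.isGeodesic.length_eq hF he hmaps', hvel'] at this
    have hEq := h.eqOn_chartGeodesic hF hu (hr v' hv').le hc'.isGeodesic
      (hvel'.trans (chartVector_chartDeriv he hy v').symm)
    have hend : expAt F y v' = expAt F y v := by
      rw [h.expAt_eq hF hy hu (hr v' hv').le, ← hc'.target, hEq (right_mem_Icc.2 zero_le_one),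
        h.chartGeodesic_eq (hr v' hv').le (right_mem_Icc.2 zero_le_one), one_smul]
    rwa [(h.isExpDiffeo hF hy hu hr).injOn hv' hv hend] at hEq

/-- Points whose coordinates are close to those of `y` are reached by short geodesics. -/
theorem mem_expBall (h : IsSprayChart F e f C R ρ u₀) (hF : IsFinslerMetric F) {y z : M}
    (hy : y ∈ e.source) (hu : e y ∈ Metric.ball u₀ (R / 2)) (hz : z ∈ e.source) {r η : ℝ}
    (hr0 : 0 ≤ r) (hr : r < ρ / 2) (hη : ∀ w, ‖w‖ ≤ r → F (chartVector e (e y, w)) < η)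
    (hyz : dist (e z) (e y) ≤ r / 2) : z ∈ expBall F y η := by
  obtain ⟨φ, hφ, -, -, -, hball⟩ := h.field.exists_openPartialHomeomorph (u := e y) h.mul_le
  obtain ⟨w, hw, hwz⟩ := hball r hr0 hr hyz
  rw [hφ] at hwz
  rw [mem_closedBall_zero_iff] at hw
  have h1 : chartDeriv e y (symmDeriv e (e y) w) = w := by
    have := chartDeriv_symmDeriv h.mem_atlas (e.map_source hy) w
    rwa [e.left_inv hy] at this
  refine ⟨symmDeriv e (e y) w, ?_, ?_⟩
  · have h2 := hη w hw
    rwa [chartVector, e.left_inv hy] at h2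
  · rw [h.expAt_eq hF hy hu (by rw [h1]; linarith), h1, hwz, e.left_inv hz]

end IsSprayChart

theorem exists_convex_neighbourhood [T2Space M] (hF : IsFinslerMetric F) (x : M) :
    ∃ ε η : ℝ, 0 < ε ∧ ε < η ∧
      (IsExpDiffeo F x ε ∧ IsOpen (expBall F x ε) ∧ x ∈ expBall F x ε) ∧
      (∀ y ∈ expBall F x ε, ∀ z ∈ expBall F x ε,
        ∃ c : ℝ → M, IsShortGeodesic F η y z c ∧
          ∀ c' : ℝ → M, IsShortGeodesic F η y z c' → EqOn c' c (Icc 0 1)) ∧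
      (∀ y ∈ expBall F x ε,
        IsExpDiffeo F y η ∧ IsOpen (expBall F y η) ∧ y ∈ expBall F y η ∧
        expBall F x ε ⊆ expBall F y η) := by
  obtain ⟨f, C, R, ρ, h⟩ := hF.exists_isSprayChart x
  set e := chartAt (EuclideanSpace ℝ (Fin n)) x
  have hρ := h.pos
  have hR : 0 < R := by linarith [h.le_half]
  have hx : x ∈ e.source := mem_chart_source _ x
  have hux : e x ∈ Metric.ball (e x) (R / 2) := Metric.mem_ball_self (by positivity)
  obtain ⟨m, B, hm, hB, hmB⟩ := hF.exists_chartMetric_bounds h.mem_atlas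
    (isCompact_closedBall (e x) R) h.subset_target
  have hsub : Metric.ball (e x) (R / 2) ⊆ Metric.closedBall (e x) R :=
    Metric.ball_subset_closedBall.trans (Metric.closedBall_subset_closedBall (by linarith))
  have hlow : ∀ y ∈ e.source, e y ∈ Metric.ball (e x) (R / 2) → ∀ δ, ∀ v ∈ indicatrix F y δ,
      m * ‖chartDeriv e y v‖ < δ := by
    intro y hy hu δ v hv
    refine ((hmB _ (hsub hu) _).1).trans_lt ?_
    rw [chartVector_chartDeriv h.mem_atlas hy]
    exact hv
  -- η makes F < η imply ‖w‖ < ρ/2. On ‖w‖ ≤ r one has F ≤ Br ≤ η/2 < η. With F < ε at x, ‖w‖ ≤ r/8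
  -- and ‖w‖ ≤ R/8, so endpoints lie within r/6 ≤ r/4 of x in the chart, hence within r/2 of each
  -- other, and inside the ball of radius R/2.
  let η := m * ρ / 2
  let r := min (η / (2 * B)) (ρ / 4)
  let ε := min (η / 2) (min (m * r / 8) (m * R / 8))
  have hη0 : 0 < η := by positivity
  have hr0 : 0 < r := by positivity
  have hε0 : 0 < ε := by positivity
  have hε1 : ε ≤ η / 2 := min_le_left _ _
  have hε2 : ε ≤ m * r / 8 := (min_le_right _ _).trans (min_le_left _ _)
  have hε3 : ε ≤ m * R / 8 := (min_le_right _ _).trans (min_le_right _ _)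
  have hεη : ε < η := by linarith
  have hrρ : r ≤ ρ / 4 := min_le_right _ _
  have hBr : B * r ≤ η / 2 := by
    calc B * r ≤ B * (η / (2 * B)) := by gcongr; exact min_le_left _ _
      _ = η / 2 := by field_simp
  have hsmall : ∀ y ∈ e.source, e y ∈ Metric.ball (e x) (R / 2) → ∀ v ∈ indicatrix F y η,
      ‖chartDeriv e y v‖ < ρ / 2 := by
    intro y hy hu v hv
    refine lt_of_mul_lt_mul_left ((hlow y hy hu η v hv).trans_eq ?_) hm.le
    ring
  have hxε : ∀ v ∈ indicatrix F x ε, ‖chartDeriv e x v‖ < ρ / 2 := fun v hv =>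
    hsmall x hx hux v (lt_trans hv hεη)
  have hpoint : ∀ y ∈ expBall F x ε, y ∈ e.source ∧ dist (e y) (e x) ≤ r / 4 ∧
      e y ∈ Metric.ball (e x) (R / 2) := by
    rintro _ ⟨v, hv, rfl⟩
    have hw := (hxε v hv).le
    have hmem := h.subset_target (Metric.ball_subset_closedBall (h.timeOneMap_mem_ball hux hw))
    have h1 := h.field.norm_timeOneMap_sub_le (u := e x) h.mul_le hw
    have h2 := hlow x hx hux ε v hv
    have h3 : ‖chartDeriv e x v‖ ≤ r / 8 :=
      le_of_mul_le_mul_left (by linarith) hm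
    have h4 : ‖chartDeriv e x v‖ ≤ R / 8 :=
      le_of_mul_le_mul_left (by linarith) hm
    rw [h.expAt_eq hF hx hux hw, Metric.mem_ball, e.right_inv hmem, dist_eq_norm]
    exact ⟨e.map_target hmem, by linarith, by linarith⟩
  have hcontain : ∀ y ∈ expBall F x ε, expBall F x ε ⊆ expBall F y η := by
    intro y hy z hz
    obtain ⟨hy1, hy2, hy3⟩ := hpoint y hy
    obtain ⟨hz1, hz2, -⟩ := hpoint z hz
    refine h.mem_expBall hF hy1 hy3 hz1 hr0.le (by linarith) (fun w hw => ?_) ?_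
    · have h1 := (hmB _ (hsub hy3) w).2
      have h2 := mul_le_mul_of_nonneg_left hw hB.le
      linarith
    · have := dist_triangle_right (e z) (e y) (e x)
      linarith
  have hxdiff := h.isExpDiffeo hF hx hux hxε
  refine ⟨ε, η, hε0, hεη, ⟨hxdiff, hxdiff.isOpen_expBall, ?_⟩, fun y hy z hz => ?_,
    fun y hy => ?_⟩
  · exact ⟨0, hF.zero_mem_indicatrix x hε0, h.expAt_zero hF hx hux⟩
  · obtain ⟨hy1, -, hy3⟩ := hpoint y hy
    exact h.exists_isShortGeodesic hF hy1 hy3 (hsmall y hy1 hy3) (hcontain y hy hz)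
  · obtain ⟨hy1, -, hy3⟩ := hpoint y hy
    have hdiff := h.isExpDiffeo hF hy1 hy3 (hsmall y hy1 hy3)
    exact ⟨hdiff, hdiff.isOpen_expBall, ⟨0, hF.zero_mem_indicatrix y hη0,
      h.expAt_zero hF hy1 hy3⟩, hcontain y hy⟩

end ConvexNeighbourhoods

end Finsler

theorem proposition1p1 {n : ℕ} {M : Type*} [TopologicalSpace M] [T2Space M]
    [ChartedSpace (EuclideanSpace ℝ (Fin n)) M] [IsManifold (𝓡 n) ∞ M]
    (F : TangentBundle (𝓡 n) M → ℝ) (hF : Finsler.IsFinslerMetric F) (x : M) :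
    ∃ ε η : ℝ, 0 < ε ∧ ε < η ∧
      (Finsler.IsExpDiffeo F x ε ∧
        IsOpen (Finsler.expBall F x ε) ∧ x ∈ Finsler.expBall F x ε) ∧
      (∀ y ∈ Finsler.expBall F x ε, ∀ z ∈ Finsler.expBall F x ε,
        ∃ c : ℝ → M, Finsler.IsShortGeodesic F η y z c ∧
          ∀ c' : ℝ → M, Finsler.IsShortGeodesic F η y z c' → Set.EqOn c' c (Set.Icc 0 1)) ∧
      (∀ y ∈ Finsler.expBall F x ε,
        Finsler.IsExpDiffeo F y η ∧
        IsOpen (Finsler.expBall F y η) ∧ y ∈ Finsler.expBall F y η ∧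
        Finsler.expBall F x ε ⊆ Finsler.expBall F y η) :=
  Finsler.exists_convex_neighbourhood hF x
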